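/- Let $n\ge 0$, $N=2^n$. For $\boldsymbol\theta=(\theta_1,\dots,\theta_n)$ define the simple scalar butterfly matrix $B(\boldsymbol\theta)\in\mathbb R^{N\times N}$ recursively by $B()=(1)$ and $$B(\theta_1,\dots,\theta_n)=\begin{bmatrix}\cos\theta_n\,A&\sin\theta_n\,A\\-\sin\theta_n\,A&\cos\theta_n\,A\end{bmatrix},\qquad A=B(\theta_1,\dots,\theta_{n-1}).$$ A Haar-butterfly matrix is a random matrix $B$ with the law of $B(\boldsymbol\theta)$ for $\theta_1,\dots,\theta_n$ iid uniform on $[0,2\pi)$. Write $\|A\|_{\max}=\max_{i,j}|A_{ij}|$ and $\|A\|_\infty=\max_i\sum_j|A_{ij}|$. Apply Gaussian elimination to $B$ either with partial pivoting (GEPP: the $k$-th pivot is an entry of largest modulus in column $k$ of the rows $i\ge k$) or with rook pivoting (GERP: the $k$-th pivot is found in the active submatrix, starting from an entry of largest modulus in its first column and moving alternately to an entry of largest modulus in the current row and in the current column, until the current entry has largest modulus both in its row and in its column); ties are broken by any fixed rule. Let $PBQ=LU$ be the resulting factorization ($L$ unit lower triangular, $U$ upper triangular, $Q=I$ for GEPP),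 let $B^{(k)}$ be the matrix before the $k$-th elimination step, $1\le k\le N$, and set $$\rho(B)=\frac{\|L\|_{\max}\max_k\|B^{(k)}\|_{\max}}{\|B\|_{\max}},\qquad \rho_o(B)=\frac{\||L||U|\|_\infty}{\|B\|_\infty},\qquad \rho_\infty(B)=\frac{\|L\|_\infty\|U\|_\infty}{\|B\|_\infty},$$ where $|\cdot|$ is taken entrywise. Then, with either pivoting strategy, these three random variables are integrable, and $$\mathbb E\,\rho(B)=N^{\log_2(4/\pi)},\qquad \mathbb E\,\rho_o(B)=N^{\log_2(6\log 2/\pi)},\qquad \mathbb E\,\rho_\infty(B)=N^{\log_2(1+\log 4/\pi)},$$ where $\log$ is the natural logarithm. Moreover, for every real $k>0$ the variable $\rho(B)^k$ is integrable and $$\mathbb E\,\rho(B)^k=N^{\alpha_k},\qquad \alpha_k=\log_2\!\Big(\tfrac2\pi\,\big|\operatorname{Im}B_2(k,\tfrac12)\big|\Big),$$ where $B_x(a,b)=\int_0^x t^{a-1}(1-t)^{b-1}\,dt$ is the incomplete beta function, with principal values of the complex powers. -/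

import Mathlib

open MeasureTheory ProbabilityTheory

noncomputable section

/-! ### Matrix norms -/

/-- The elementwise max norm `‖A‖_max = max_{i,j} |A i j|`. -/
def maxNorm {N : ℕ} (A : Matrix (Fin N) (Fin N) ℝ) : ℝ :=
  (Matrix.normedAddCommGroup : NormedAddCommGroup (Matrix (Fin N) (Fin N) ℝ)).norm A

/-- The matrix norm `‖A‖_∞` induced by the `ℓ_∞` vector norm (the maximal absolute row sum). -/
def infNorm {N : ℕ} (A : Matrix (Fin N) (Fin N) ℝ) : ℝ :=
  (Matrix.linftyOpNormedAddCommGroup : NormedAddCommGroup (Matrix (Fin N) (Fin N) ℝ)).norm A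

/-! ### Gaussian elimination with pivoting -/

/-- A pivoting rule for `N × N` matrices: at step `k`, with current matrix `M` (whose first `k`
columns have already been eliminated), it returns the position (row, column) of the pivot entry. -/
abbrev PivotRule (N : ℕ) : Type :=
  Fin N → Matrix (Fin N) (Fin N) ℝ → Fin N × Fin N

/-- Partial pivoting: at step `k` the pivot is an entry of maximal modulus in column `k`, among the
rows `i ≥ k`. Ties may be broken in any way. -/
def IsPartialPivoting {N : ℕ} (σ : PivotRule N) : Prop :=
  ∀ (k : Fin N) (M : Matrix (Fin N) (Fin N) ℝ),
    (σ k M).2 = k ∧ k ≤ (σ k M).1 ∧ ∀ i, k ≤ i → |M i k| ≤ |M (σ k M).1 k|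

/-- The positions visited by the rook search in the active submatrix (rows and columns `≥ k`) of
`M`: the search starts at an entry of maximal modulus in the leading column, and then moves
alternately to an entry of maximal modulus in the current row and in the current column, as long as
such a move strictly increases the modulus. -/
inductive RookSearch {N : ℕ} (k : Fin N) (M : Matrix (Fin N) (Fin N) ℝ) : Fin N → Fin N → Prop
  | start (i : Fin N) (hi : k ≤ i) (hmax : ∀ i', k ≤ i' → |M i' k| ≤ |M i k|) :
      RookSearch k M i k
  | row (i j j' : Fin N) (h : RookSearch k M i j) (hj' : k ≤ j') (hlt : |M i j| < |M i j'|)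
      (hmax : ∀ l, k ≤ l → |M i l| ≤ |M i j'|) : RookSearch k M i j'
  | col (i i' j : Fin N) (h : RookSearch k M i j) (hi' : k ≤ i') (hlt : |M i j| < |M i' j|)
      (hmax : ∀ l, k ≤ l → |M l j| ≤ |M i' j|) : RookSearch k M i' j

/-- Rook pivoting: the pivot is a position at which the rook search stops, that is, an entry of
maximal modulus both in its row and in its column of the active submatrix. Ties may be broken in
any way. -/
def IsRookPivoting {N : ℕ} (σ : PivotRule N) : Prop :=
  ∀ (k : Fin N) (M : Matrix (Fin N) (Fin N) ℝ),
    RookSearch k M (σ k M).1 (σ k M).2 ∧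
    (∀ i, k ≤ i → |M i (σ k M).2| ≤ |M (σ k M).1 (σ k M).2|) ∧
    (∀ j, k ≤ j → |M (σ k M).1 j| ≤ |M (σ k M).1 (σ k M).2|)

/-- The state of Gaussian elimination: the current (partially eliminated) matrix, and the strictly
lower triangular matrix of the multipliers found so far. -/
structure GEState (N : ℕ) where
  mat : Matrix (Fin N) (Fin N) ℝ
  mult : Matrix (Fin N) (Fin N) ℝ

/-- One elimination step: the pivot is moved to position `(k, k)` by a row swap and a column swap
(the multipliers found earlier move along with their rows), and then the entries below it in
column `k` are eliminated. -/
def geStep {N : ℕ} (σ : PivotRule N) (k : Fin N) (S : GEState N) : GEState N :=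
  let p := σ k S.mat
  let M := S.mat.submatrix (Equiv.swap k p.1) (Equiv.swap k p.2)
  let K := S.mult.submatrix (Equiv.swap k p.1) id
  { mat := Matrix.of fun i j => if k < i then M i j - M i k / M k k * M k j else M i j
    mult := Matrix.of fun i j => if k < i ∧ j = k then M i k / M k k else K i j }

/-- The state after the first `k` steps of Gaussian elimination applied to `A`
(there are `N` steps in all, the last of which eliminates nothing). -/
def geState {N : ℕ} (σ : PivotRule N) (A : Matrix (Fin N) (Fin N) ℝ) : ℕ → GEState N
  | 0 => ⟨A, 0⟩
  | k + 1 => if h : k < N then geStep σ ⟨k, h⟩ (geState σ A k) else geState σ A k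

/-- The unit lower triangular factor `L` of the factorization `P A Q = L U`. -/
def geL {N : ℕ} (σ : PivotRule N) (A : Matrix (Fin N) (Fin N) ℝ) : Matrix (Fin N) (Fin N) ℝ :=
  1 + (geState σ A N).mult

/-- The upper triangular factor `U` of the factorization `P A Q = L U`. -/
def geU {N : ℕ} (σ : PivotRule N) (A : Matrix (Fin N) (Fin N) ℝ) : Matrix (Fin N) (Fin N) ℝ :=
  (geState σ A N).mat

/-! ### Growth factors -/

/-- The growth factor `ρ(A) = ‖L‖_max · max_k ‖A^(k)‖_max / ‖A‖_max`, with `A^(k)` the matrix before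
the `k`-th elimination step (here `k` counts from `0`). Row and column swaps do not affect
`‖A^(k)‖_max`. -/
def growthMax {N : ℕ} (σ : PivotRule N) (A : Matrix (Fin N) (Fin N) ℝ) : ℝ :=
  maxNorm (geL σ A) * (⨆ k : Fin N, maxNorm (geState σ A k).mat) / maxNorm A

/-- The growth factor `ρ_o(A) = ‖ |L| |U| ‖_∞ / ‖A‖_∞`, with entrywise absolute values. -/
def growthO {N : ℕ} (σ : PivotRule N) (A : Matrix (Fin N) (Fin N) ℝ) : ℝ :=
  infNorm ((geL σ A).map (fun x => |x|) * (geU σ A).map (fun x => |x|)) / infNorm A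

/-- The growth factor `ρ_∞(A) = ‖L‖_∞ ‖U‖_∞ / ‖A‖_∞`. -/
def growthInf {N : ℕ} (σ : PivotRule N) (A : Matrix (Fin N) (Fin N) ℝ) : ℝ :=
  infNorm (geL σ A) * infNorm (geU σ A) / infNorm A

/-! ### Haar-butterfly matrices -/

/-- The simple scalar butterfly matrix `B(θ)` of size `2 ^ n`: it is `(1)` for `n = 0`, and the
block matrix `[c A, s A; -s A, c A]` otherwise, where `c, s` are the cosine and sine of the last
angle and `A` is the butterfly matrix formed with the other angles. -/
def butterfly : (n : ℕ) → (Fin n → ℝ) → Matrix (Fin (2 ^ n)) (Fin (2 ^ n)) ℝ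
  | 0, _ => 1
  | n + 1, θ =>
    let A := butterfly n (Fin.init θ)
    let c := Real.cos (θ (Fin.last n))
    let s := Real.sin (θ (Fin.last n))
    let e : Fin (2 ^ n) ⊕ Fin (2 ^ n) ≃ Fin (2 ^ (n + 1)) :=
      finSumFinEquiv.trans (finCongr (by rw [pow_succ, mul_two]))
    Matrix.reindex e e (Matrix.fromBlocks (c • A) (s • A) (-s • A) (c • A))

/-- The (Borel) product sigma-algebra on real matrices. -/
instance matrixMeasurableSpace {N : ℕ} : MeasurableSpace (Matrix (Fin N) (Fin N) ℝ) :=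
  inferInstanceAs (MeasurableSpace (Fin N → Fin N → ℝ))

/-- The matrix `B(θ)` depends measurably on the angles, so that it has a law. -/
theorem measurable_butterfly (n : ℕ) : Measurable (butterfly n) := by
  induction n with
  | zero => exact measurable_const
  | succ n ih =>
    have hA : ∀ i j, Measurable fun θ : Fin (n + 1) → ℝ => butterfly n (Fin.init θ) i j := by
      intro i j
      have h1 : Measurable fun θ : Fin (n + 1) → ℝ => (Fin.init θ : Fin n → ℝ) :=
        measurable_pi_lambda _ fun k => measurable_pi_apply _
      exact (measurable_pi_apply j).comp ((measurable_pi_apply i).comp (ih.comp h1))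
    refine measurable_pi_lambda _ fun i => measurable_pi_lambda _ fun j => ?_
    simp only [butterfly, Matrix.reindex_apply, Matrix.submatrix_apply]
    rcases (finSumFinEquiv.trans (finCongr _)).symm i with a | a <;>
    rcases (finSumFinEquiv.trans (finCongr _)).symm j with b | b <;>
    simp only [Matrix.fromBlocks_apply₁₁, Matrix.fromBlocks_apply₁₂, Matrix.fromBlocks_apply₂₁,
      Matrix.fromBlocks_apply₂₂, Matrix.smul_apply, smul_eq_mul] <;>
    exact Measurable.mul (by fun_prop) (hA a b)

/-- The law of a Haar-butterfly matrix of size `2 ^ n`: the law of `B(θ)` for independent angles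
`θ 0, …, θ (n - 1)`, each uniformly distributed on `[0, 2π)`. -/
def haarButterfly (n : ℕ) : Measure (Matrix (Fin (2 ^ n)) (Fin (2 ^ n)) ℝ) :=
  (Measure.pi fun _ : Fin n => (volume : Measure ℝ)[|Set.Ico 0 (2 * Real.pi)]).map (butterfly n)

/-! ### The incomplete beta function -/

/-- The incomplete beta function `B_x(a, b) = ∫_0^x t^(a-1) (1-t)^(b-1) dt`, with principal values
of the complex powers (`1 - t` is negative for `t > 1`). -/
def incompleteBeta (x : ℝ) (a b : ℂ) : ℂ :=
  ∫ t : ℝ in 0..x, (t : ℂ) ^ (a - 1) * (1 - (t : ℂ)) ^ (b - 1)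

end

/-! For almost every angle the two entries in the first column of the rotation have different
nonzero moduli. Putting the larger one on top gives rows `(p, q)` and `ε (-q, p)` with `ε = ±1`,
`|q| < |p|`, `p ^ 2 + q ^ 2 = 1`, and this matrix factors as `[1, 0; -εq/p, 1] * [p, q; 0, ε/p]`. A
butterfly matrix is an iterated Kronecker product of rotations, and Kronecker products of triangular
factors are triangular. So, up to a row permutation, it equals `L * U` with explicit factors, all
multipliers below 1 in modulus and every pivot maximal in its row of `U`. Such a factorization
leaves no choice: every leading column has a unique largest entry, and the rook search stops there
at once, so both strategies produce exactly these factors (`IsRookLU.geL_eq_and_geU_eq`).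

With `t = |q| / |p|`, that is `|tan|` or its inverse, whichever is at most 1, each angle contributes
to the three growth factors a factor `1 + t ^ 2`, `(1 + t + 2t ^ 2) / (1 + t)` and `1 + t`
respectively (`exists_isRookLU_butterfly`). For `growthMax` this requires control of all
intermediate Schur complements, not only of `U`; see `abs_tailProduct_kron₂_le`.

By independence each mean is the `n`-th power of a single mean, which by symmetry is `4/π` times the
integral of `f (tan x)` over `[0, π/4]`. The first three integrals are elementary; for the moments,
the substitution `1 + tan ^ 2` gives the part over `[1, 2]` of the integral defining the incomplete
beta function, the only part that is not real. -/

/-! ### Elimination of a matrix with a known triangular factorization -/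

/-- The contribution of the rows `l ≥ k` of `U` to the product `L * U`. For `L` lower and `U` upper
triangular, its rows `i ≥ k` form the Schur complement left by `k` elimination steps. -/
noncomputable def tailProduct {N : ℕ} (L U : Matrix (Fin N) (Fin N) ℝ) (k : ℕ) :
    Matrix (Fin N) (Fin N) ℝ :=
  Matrix.of fun i j => ∑ l : Fin N, if k ≤ l then L i l * U l j else 0

/-- Triangular factors whose multipliers are strictly dominated by the pivots, and whose pivots are
maximal in their rows: these are reproduced by partial and by rook pivoting alike. -/
structure IsRookLU {N : ℕ} (L U : Matrix (Fin N) (Fin N) ℝ) : Prop where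
  diag : ∀ i, L i i = 1
  lower : ∀ i j, i < j → L i j = 0
  lt_one : ∀ i j, j < i → |L i j| < 1
  upper : ∀ i j, j < i → U i j = 0
  pivot_ne_zero : ∀ i, U i i ≠ 0
  row_le : ∀ i j, |U i j| ≤ |U i i|

theorem tailProduct_zero {N : ℕ} (L U : Matrix (Fin N) (Fin N) ℝ) : tailProduct L U 0 = L * U := by
  ext i j
  simp [tailProduct, Matrix.mul_apply]

/-- Peeling off one rank-one term is what a single elimination step does to the active rows. -/
theorem tailProduct_succ {N : ℕ} (L U : Matrix (Fin N) (Fin N) ℝ) (k i j : Fin N) :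
    tailProduct L U (k + 1) i j = tailProduct L U k i j - L i k * U k j := by
  have h : L i k * U k j = ∑ l : Fin N, if l = k then L i l * U l j else 0 := by simp
  rw [h]
  simp only [tailProduct, Matrix.of_apply]
  rw [← Finset.sum_sub_distrib]
  refine Finset.sum_congr rfl fun l _ => ?_
  rcases lt_trichotomy l k with h | h | h
  · have h1 : ¬ (k : ℕ) + 1 ≤ l := by omega
    have h2 : ¬ (k : ℕ) ≤ l := by omega
    simp [h1, h2, h.ne]
  · subst h; simp
  · have h1 : (k : ℕ) + 1 ≤ l := by omega
    have h2 : (k : ℕ) ≤ l := by omega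
    simp [h1, h2, h.ne']

namespace IsRookLU

variable {N : ℕ} {L U : Matrix (Fin N) (Fin N) ℝ}

theorem abs_le_one (h : IsRookLU L U) (i j : Fin N) : |L i j| ≤ 1 := by
  rcases lt_trichotomy i j with hij | hij | hij
  · simp [h.lower i j hij]
  · simp [hij, h.diag]
  · exact (h.lt_one i j hij).le

theorem tailProduct_pivot_col (h : IsRookLU L U) (i k : Fin N) :
    tailProduct L U k i k = L i k * U k k := by
  simp only [tailProduct, Matrix.of_apply]
  rw [Finset.sum_eq_single k]
  · simp
  · intro l _ hl
    split_ifs with hk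
    · rw [h.upper l k (lt_of_le_of_ne hk hl.symm), mul_zero]
    · rfl
  · simp

theorem tailProduct_pivot_row (h : IsRookLU L U) (k j : Fin N) :
    tailProduct L U k k j = U k j := by
  simp only [tailProduct, Matrix.of_apply]
  rw [Finset.sum_eq_single k]
  · simp [h.diag]
  · intro l _ hl
    split_ifs with hk
    · rw [h.lower k l (lt_of_le_of_ne hk hl.symm), zero_mul]
    · rfl
  · simp

/-- A matrix whose active rows are, up to a permutation `τ`, those of the Schur complement: both
pivoting strategies pick the entry of the leading column in the row sent to `k` by `τ`. -/
theorem pivot_eq (h : IsRookLU L U) {σ : PivotRule N}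
    (hσ : IsPartialPivoting σ ∨ IsRookPivoting σ) (k : Fin N) (M : Matrix (Fin N) (Fin N) ℝ)
    (τ : Equiv.Perm (Fin N)) (hτ : ∀ i, k ≤ i → k ≤ τ i) (hk : k ≤ τ.symm k)
    (hM : ∀ i j, k ≤ i → M i j = tailProduct L U k (τ i) j) :
    (σ k M).2 = k ∧ k ≤ (σ k M).1 ∧ τ (σ k M).1 = k := by
  have hcol : ∀ i, k ≤ i → M i k = L (τ i) k * U k k := fun i hi => by
    rw [hM i k hi, h.tailProduct_pivot_col]
  have hmaxcol : ∀ i, k ≤ i → |M i k| ≤ |U k k| := fun i hi => by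
    rw [hcol i hi, abs_mul]
    exact mul_le_of_le_one_left (abs_nonneg _) (h.abs_le_one _ _)
  have hpiv : M (τ.symm k) k = U k k := by simp [hcol _ hk, h.diag]
  -- Any other active row has its multiplier strictly below 1, so the largest entry of the leading
  -- column is unique.
  have hstart : ∀ i, k ≤ i → (∀ i', k ≤ i' → |M i' k| ≤ |M i k|) → τ i = k := by
    intro i hi hmax
    by_contra hne
    have h1 := hmax _ hk
    rw [hpiv, hcol i hi, abs_mul] at h1
    have h2 := h.lt_one (τ i) k (lt_of_le_of_ne (hτ i hi) (Ne.symm hne))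
    have h3 : 0 < |U k k| := abs_pos.2 (h.pivot_ne_zero k)
    nlinarith
  rcases hσ with hσ | hσ
  · obtain ⟨h1, h2, h3⟩ := hσ k M
    exact ⟨h1, h2, hstart _ h2 h3⟩
  · have key : ∀ i j, RookSearch k M i j → j = k ∧ k ≤ i ∧ τ i = k := by
      intro i j hs
      induction hs with
      | start i hi hmax => exact ⟨rfl, hi, hstart i hi hmax⟩
      -- The search cannot leave its starting point: the pivot is already maximal in its row of `U`,
      -- and in the next case in its column.
      | row i j j' _ hj' hlt _ ih =>
        obtain ⟨rfl, hi, hτi⟩ := ih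
        have h1 := h.row_le j j'
        rw [hM i j hi, hM i j' hi, hτi, h.tailProduct_pivot_row, h.tailProduct_pivot_row] at hlt
        exact absurd hlt (not_lt.2 h1)
      | col i i' j _ hi' hlt _ ih =>
        obtain ⟨rfl, hi, hτi⟩ := ih
        have h1 := hmaxcol i' hi'
        rw [hM i j hi, hτi, h.tailProduct_pivot_row] at hlt
        exact absurd hlt (not_lt.2 h1)
    exact key _ _ (hσ k M).1

/-- The states of Gaussian elimination, up to the order of the active rows. -/
theorem exists_geState_eq (h : IsRookLU L U) {σ : PivotRule N}
    (hσ : IsPartialPivoting σ ∨ IsRookPivoting σ) {A : Matrix (Fin N) (Fin N) ℝ}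
    (π : Equiv.Perm (Fin N)) (hA : A.submatrix π id = L * U) (k : ℕ) (hkN : k ≤ N) :
    ∃ τ : Equiv.Perm (Fin N), (∀ i : Fin N, i < k → τ i = i) ∧
      (∀ i j, (geState σ A k).mat i j =
        if τ i < k then U (τ i) j else tailProduct L U k (τ i) j) ∧
      (∀ i j, (geState σ A k).mult i j = if j < k ∧ j < τ i then L (τ i) j else 0) := by
  induction k with
  | zero =>
    refine ⟨π.symm, by simp, fun i j => ?_, by simp [geState]⟩
    have := congrFun (congrFun hA (π.symm i)) j
    simpa [tailProduct_zero, geState] using this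
  | succ k ih =>
    obtain ⟨τ, hfix, hmat, hmult⟩ := ih (by omega)
    have hk : k < N := by omega
    set κ : Fin N := ⟨k, hk⟩ with hκ
    have hge : ∀ i, κ ≤ i → κ ≤ τ i := by
      intro i hi
      by_contra hlt
      have hlt' : τ i < κ := not_le.1 hlt
      have := τ.injective (hfix (τ i) hlt')
      rw [this] at hlt
      exact hlt hi
    have hκs : κ ≤ τ.symm κ := by
      by_contra hlt
      have := hfix (τ.symm κ) (not_le.1 hlt)
      rw [Equiv.apply_symm_apply] at this
      exact hlt this.le
    have hM : ∀ i j, κ ≤ i → (geState σ A k).mat i j = tailProduct L U κ (τ i) j := by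
      intro i j hi
      have : ¬ ((τ i : Fin N) : ℕ) < k := not_lt.2 (hge i hi)
      rw [hmat, if_neg this]
    obtain ⟨hp2, hp1, hτp⟩ := h.pivot_eq hσ κ (geState σ A k).mat τ hge hκs hM
    set p := (σ κ (geState σ A k).mat).1 with hp
    -- `τ i` records which row of `L * U` currently sits in position `i`; the row swap is composed
    -- with it.
    set τ' : Equiv.Perm (Fin N) := (Equiv.swap κ p).trans τ with hτ'
    have hτ'a : ∀ i, τ (Equiv.swap κ p i) = τ' i := fun i => rfl
    have hτ'κ : τ' κ = κ := by rw [← hτ'a, Equiv.swap_apply_left, hτp]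
    have hfix' : ∀ i : Fin N, i < κ → τ' i = i := by
      intro i hi
      rw [← hτ'a, Equiv.swap_apply_of_ne_of_ne hi.ne (hi.trans_le hp1).ne]
      exact hfix i hi
    have hgt : ∀ i, κ < τ' i ↔ κ < i := by
      intro i
      constructor
      · intro hi
        by_contra hle
        rcases (not_lt.1 hle).lt_or_eq with hl | hl
        · rw [hfix' i hl] at hi; exact hle hi
        · rw [hl, hτ'κ] at hi; exact lt_irrefl _ hi
      · intro hi
        by_contra hle
        rcases (not_lt.1 hle).lt_or_eq with hl | hl
        · have := τ'.injective (hfix' _ hl)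
          rw [this] at hl; exact lt_asymm hl hi
        · have := τ'.injective (hl.trans hτ'κ.symm)
          exact hi.ne' this
    have hstep : geState σ A (k + 1) = geStep σ κ (geState σ A k) := by
      rw [geState, dif_pos hk]
    have hκκ : (geState σ A k).mat (Equiv.swap κ p κ) κ = U κ κ := by
      rw [hM _ _ (by rw [Equiv.swap_apply_left]; exact hp1), hτ'a, hτ'κ, h.tailProduct_pivot_row]
    have hκj : ∀ j, (geState σ A k).mat (Equiv.swap κ p κ) j = U κ j := fun j => by
      rw [hM _ _ (by rw [Equiv.swap_apply_left]; exact hp1), hτ'a, hτ'κ, h.tailProduct_pivot_row]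
    have hgtM : ∀ i j, κ < i →
        (geState σ A k).mat (Equiv.swap κ p i) j = tailProduct L U κ (τ' i) j := by
      intro i j hi
      rw [hmat, hτ'a, if_neg]
      exact not_lt.2 ((hgt i).2 hi).le
    refine ⟨τ', ?_, ?_, ?_⟩
    · intro i hi
      rcases (Nat.lt_succ_iff.1 hi).lt_or_eq with hl | hl
      · exact hfix' i hl
      · have : i = κ := Fin.ext hl
        rw [this, hτ'κ]
    · intro i j
      rw [hstep]
      simp only [geStep, Matrix.of_apply, Matrix.submatrix_apply, hp2, ← hp, Equiv.swap_self,
        Equiv.refl_apply]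
      -- Below the pivot, dividing the leading column by `U κ κ` recovers the column of `L`, and the
      -- update is `tailProduct_succ`. The other rows are already rows of `U`.
      by_cases hi : κ < i
      · have h1 : ¬ ((τ' i : Fin N) : ℕ) < k + 1 := not_lt.2 (Nat.succ_le_of_lt ((hgt i).2 hi))
        rw [if_pos hi, if_neg h1, hgtM i j hi, hgtM i κ hi, hκj, hκj, h.tailProduct_pivot_col,
          mul_div_cancel_right₀ _ (h.pivot_ne_zero κ)]
        exact (tailProduct_succ L U κ (τ' i) j).symm
      · have h1 : ((τ' i : Fin N) : ℕ) < k + 1 :=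
          Nat.lt_succ_of_le (not_lt.1 (mt (hgt i).1 hi))
        rw [if_neg hi, if_pos h1]
        rcases (not_lt.1 hi).lt_or_eq with hl | hl
        · rw [hmat, hτ'a, if_pos]
          rw [hfix' i hl]; exact hl
        · rw [hl, hκj, hτ'κ]
    · intro i j
      rw [hstep]
      simp only [geStep, Matrix.of_apply, Matrix.submatrix_apply, hp2, ← hp, Equiv.swap_self,
        Equiv.refl_apply, id]
      rw [hmult, hτ'a]
      by_cases hj : j = κ
      · by_cases hi : κ < i
        · have h1 : (j : ℕ) < k + 1 ∧ j < τ' i := by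
            rw [hj]; exact ⟨Nat.lt_succ_self k, (hgt i).2 hi⟩
          rw [if_pos ⟨hi, hj⟩, if_pos h1, hj, hgtM i κ hi, hκj, h.tailProduct_pivot_col,
            mul_div_cancel_right₀ _ (h.pivot_ne_zero κ)]
        · have h1 : ¬ j < τ' i := by rw [hj]; exact mt (hgt i).1 hi
          rw [if_neg fun h => hi h.1, if_neg fun h => h1 h.2, if_neg fun h => h1 h.2]
      · have h1 : (j : ℕ) < k + 1 ↔ (j : ℕ) < k := by
          have : (j : ℕ) ≠ k := fun e => hj (Fin.ext e)
          omega
        rw [if_neg fun h => hj h.2]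
        simp only [h1]

/-- After `N` steps the permutation of the rows fixes every index, so nothing depends on the rule
for ties. -/
theorem geL_eq_and_geU_eq (h : IsRookLU L U) {σ : PivotRule N}
    (hσ : IsPartialPivoting σ ∨ IsRookPivoting σ) {A : Matrix (Fin N) (Fin N) ℝ}
    (π : Equiv.Perm (Fin N)) (hA : A.submatrix π id = L * U) : geL σ A = L ∧ geU σ A = U := by
  obtain ⟨τ, hfix, hmat, hmult⟩ := h.exists_geState_eq hσ π hA N le_rfl
  have hτ : ∀ i, τ i = i := fun i => hfix i i.2
  constructor
  · ext i j
    rw [geL, Matrix.add_apply, hmult, hτ]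
    rcases lt_trichotomy i j with hij | hij | hij
    · simp [hij.ne, hij.not_gt, h.lower i j hij]
    · subst hij
      simp [h.diag]
    · simp [hij, hij.ne']
  · ext i j
    rw [geU, hmat, hτ, if_pos i.2]

end IsRookLU

/-! ### Norms -/

theorem maxNorm_le_iff {N : ℕ} {A : Matrix (Fin N) (Fin N) ℝ} {r : ℝ} (hr : 0 ≤ r) :
    maxNorm A ≤ r ↔ ∀ i j, |A i j| ≤ r :=
  Matrix.norm_le_iff hr

theorem abs_le_maxNorm {N : ℕ} (A : Matrix (Fin N) (Fin N) ℝ) (i j : Fin N) :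
    |A i j| ≤ maxNorm A :=
  Matrix.norm_entry_le_entrywise_sup_norm A

theorem maxNorm_eq {N : ℕ} {A : Matrix (Fin N) (Fin N) ℝ} {r : ℝ} (h : ∀ i j, |A i j| ≤ r)
    {i j : Fin N} (hij : |A i j| = r) : maxNorm A = r :=
  le_antisymm ((maxNorm_le_iff (hij ▸ abs_nonneg _)).2 h) (hij ▸ abs_le_maxNorm A i j)

theorem exists_abs_eq_maxNorm {N : ℕ} [NeZero N] (A : Matrix (Fin N) (Fin N) ℝ) :
    ∃ i j, |A i j| = maxNorm A := by
  obtain ⟨⟨i, j⟩, h⟩ := Finite.exists_max fun x : Fin N × Fin N => |A x.1 x.2|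
  exact ⟨i, j, (maxNorm_eq (fun i' j' => h (i', j')) rfl).symm⟩

theorem infNorm_le_iff {N : ℕ} {A : Matrix (Fin N) (Fin N) ℝ} {r : ℝ} (hr : 0 ≤ r) :
    infNorm A ≤ r ↔ ∀ i, ∑ j, |A i j| ≤ r := by
  have h : infNorm A = ((Finset.univ.sup fun i => ∑ j, ‖A i j‖₊ : NNReal) : ℝ) :=
    Matrix.linfty_opNorm_def A
  lift r to NNReal using hr
  rw [h, NNReal.coe_le_coe, Finset.sup_le_iff]
  simp only [Finset.mem_univ, true_implies, ← NNReal.coe_le_coe, NNReal.coe_sum, coe_nnnorm,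
    Real.norm_eq_abs]

theorem sum_abs_le_infNorm {N : ℕ} (A : Matrix (Fin N) (Fin N) ℝ) (i : Fin N) :
    ∑ j, |A i j| ≤ infNorm A :=
  (infNorm_le_iff (@norm_nonneg _
    Matrix.linftyOpNormedAddCommGroup.toSeminormedAddCommGroup.toSeminormedAddGroup A)).1 le_rfl i

theorem exists_sum_abs_eq_infNorm {N : ℕ} [NeZero N] (A : Matrix (Fin N) (Fin N) ℝ) :
    ∃ i, ∑ j, |A i j| = infNorm A := by
  obtain ⟨i, h⟩ := Finite.exists_max fun i => ∑ j, |A i j|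
  exact ⟨i, le_antisymm (sum_abs_le_infNorm A i)
    ((infNorm_le_iff (Finset.sum_nonneg fun j _ => abs_nonneg _)).2 h)⟩

theorem IsRookLU.growthMax_eq {N : ℕ} [NeZero N] {L U : Matrix (Fin N) (Fin N) ℝ}
    (h : IsRookLU L U) {σ : PivotRule N} (hσ : IsPartialPivoting σ ∨ IsRookPivoting σ)
    {A : Matrix (Fin N) (Fin N) ℝ} (π : Equiv.Perm (Fin N)) (hA : A.submatrix π id = L * U)
    {G : ℝ} (hG : ∀ (k : ℕ) i j, |tailProduct L U k i j| ≤ G) (hU : ∃ i j, |U i j| = G) :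
    growthMax σ A = G / maxNorm A := by
  obtain ⟨r, c, hrc⟩ := hU
  have hL : maxNorm L = 1 :=
    maxNorm_eq h.abs_le_one (i := 0) (j := 0) (by rw [h.diag, abs_one])
  have hle : ∀ k : Fin N, maxNorm (geState σ A k).mat ≤ G := by
    intro k
    obtain ⟨τ, -, hmat, -⟩ := h.exists_geState_eq hσ π hA k k.2.le
    refine (maxNorm_le_iff (hrc ▸ abs_nonneg _)).2 fun i j => ?_
    rw [hmat]
    split_ifs
    · rw [← h.tailProduct_pivot_row]; exact hG _ _ _
    · exact hG _ _ _
  have hsup : (⨆ k : Fin N, maxNorm (geState σ A k).mat) = G := by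
    refine le_antisymm (ciSup_le hle) ?_
    refine le_trans ?_ (le_ciSup (Set.finite_range _).bddAbove r)
    -- Row `r` of `U` is already present, as an active row, before step `r`; hence the bound is
    -- attained.
    obtain ⟨τ, -, hmat, -⟩ := h.exists_geState_eq hσ π hA r r.2.le
    have h1 := abs_le_maxNorm (geState σ A r).mat (τ.symm r) c
    rwa [hmat, Equiv.apply_symm_apply, if_neg (lt_irrefl _), h.tailProduct_pivot_row, hrc] at h1
  rw [growthMax, (h.geL_eq_and_geU_eq hσ π hA).1, hL, hsup, one_mul]

/-! ### Kronecker products with two by two matrices -/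

/-- The two halves of the index set of a matrix of size `2 ^ (n + 1)`. -/
def halves (n : ℕ) : Fin (2 ^ n) ⊕ Fin (2 ^ n) ≃ Fin (2 ^ (n + 1)) :=
  finSumFinEquiv.trans (finCongr (by rw [pow_succ, mul_two]))

theorem val_halves_inl {n : ℕ} (i : Fin (2 ^ n)) : (halves n (Sum.inl i) : ℕ) = i := by
  simp [halves]

theorem val_halves_inr {n : ℕ} (i : Fin (2 ^ n)) : (halves n (Sum.inr i) : ℕ) = 2 ^ n + i := by
  simp [halves, add_comm]

theorem sum_halves {n : ℕ} (f : Fin (2 ^ (n + 1)) → ℝ) :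
    ∑ l, f l = ∑ i, f (halves n (Sum.inl i)) + ∑ i, f (halves n (Sum.inr i)) := by
  rw [← Equiv.sum_comp (halves n) f, Fintype.sum_sum_type]

theorem forall_halves {n : ℕ} {p : Fin (2 ^ (n + 1)) → Prop} :
    (∀ i, p i) ↔ (∀ i, p (halves n (Sum.inl i))) ∧ ∀ i, p (halves n (Sum.inr i)) := by
  rw [← (halves n).forall_congr_right, Sum.forall]

/-- The Kronecker product of the matrix with rows `(a, b)` and `(c, d)` with `M`. -/
def kron₂ {n : ℕ} (a b c d : ℝ) (M : Matrix (Fin (2 ^ n)) (Fin (2 ^ n)) ℝ) :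
    Matrix (Fin (2 ^ (n + 1))) (Fin (2 ^ (n + 1))) ℝ :=
  Matrix.reindex (halves n) (halves n) (Matrix.fromBlocks (a • M) (b • M) (c • M) (d • M))

section kron₂

variable {n : ℕ} (a b c d : ℝ) (M : Matrix (Fin (2 ^ n)) (Fin (2 ^ n)) ℝ) (i j : Fin (2 ^ n))

@[simp] theorem kron₂_inl_inl :
    kron₂ a b c d M (halves n (Sum.inl i)) (halves n (Sum.inl j)) = a * M i j := by
  simp [kron₂]

@[simp] theorem kron₂_inl_inr :
    kron₂ a b c d M (halves n (Sum.inl i)) (halves n (Sum.inr j)) = b * M i j := by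
  simp [kron₂]

@[simp] theorem kron₂_inr_inl :
    kron₂ a b c d M (halves n (Sum.inr i)) (halves n (Sum.inl j)) = c * M i j := by
  simp [kron₂]

@[simp] theorem kron₂_inr_inr :
    kron₂ a b c d M (halves n (Sum.inr i)) (halves n (Sum.inr j)) = d * M i j := by
  simp [kron₂]

theorem kron₂_mul (a' b' c' d' : ℝ) (M' : Matrix (Fin (2 ^ n)) (Fin (2 ^ n)) ℝ) :
    kron₂ a b c d M * kron₂ a' b' c' d' M' =
      kron₂ (a * a' + b * c') (a * b' + b * d') (c * a' + d * c') (c * b' + d * d') (M * M') := by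
  simp only [kron₂, Matrix.reindex_apply, Matrix.submatrix_mul_equiv, Matrix.fromBlocks_multiply,
    Matrix.smul_mul, Matrix.mul_smul, smul_smul, ← add_smul, mul_comm]

theorem kron₂_map_abs :
    (kron₂ a b c d M).map (fun x => |x|) = kron₂ |a| |b| |c| |d| (M.map fun x => |x|) := by
  ext i j
  revert i j
  simp [forall_halves, abs_mul]

theorem kron₂_submatrix (π : Equiv.Perm (Fin (2 ^ n))) :
    (kron₂ a b c d M).submatrix (((halves n).symm.trans (Equiv.sumCongr π π)).trans (halves n)) id =
      kron₂ a b c d (M.submatrix π id) := by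
  ext i j
  revert i j
  simp [forall_halves]

/-- This is the permutation for angles with `|cos| < |sin|`, where the larger entry of the first
column of the rotation is in the lower half. -/
theorem kron₂_submatrix_swap (π : Equiv.Perm (Fin (2 ^ n))) :
    (kron₂ a b c d M).submatrix (((halves n).symm.trans
      ((Equiv.sumCongr π π).trans (Equiv.sumComm _ _))).trans (halves n)) id =
      kron₂ c d a b (M.submatrix π id) := by
  ext i j
  revert i j
  simp [forall_halves]

theorem infNorm_kron₂ :
    infNorm (kron₂ a b c d M) = max (|a| + |b|) (|c| + |d|) * infNorm M := by
  have hsum : ∀ x y : ℝ, ∀ i, ∑ j, |x * M i j| + ∑ j, |y * M i j| =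
      (|x| + |y|) * ∑ j, |M i j| := fun x y i => by
    simp only [abs_mul, ← Finset.mul_sum, add_mul]
  have hpos : 0 ≤ infNorm M :=
    (Finset.sum_nonneg fun j _ => abs_nonneg _).trans (sum_abs_le_infNorm M 0)
  refine le_antisymm ((infNorm_le_iff (by positivity)).2 ?_) ?_
  · rw [forall_halves]
    constructor <;> intro i <;> rw [sum_halves] <;> simp only [kron₂_inl_inl, kron₂_inl_inr,
      kron₂_inr_inl, kron₂_inr_inr, hsum] <;>
    refine mul_le_mul ?_ (sum_abs_le_infNorm M i) (by positivity) (by positivity)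
    · exact le_max_left _ _
    · exact le_max_right _ _
  · obtain ⟨i, hi⟩ := exists_sum_abs_eq_infNorm M
    have h1 := sum_abs_le_infNorm (kron₂ a b c d M) (halves n (Sum.inl i))
    have h2 := sum_abs_le_infNorm (kron₂ a b c d M) (halves n (Sum.inr i))
    rw [sum_halves] at h1 h2
    simp only [kron₂_inl_inl, kron₂_inl_inr, kron₂_inr_inl, kron₂_inr_inr, hsum, hi] at h1 h2
    rw [max_mul_of_nonneg _ _ hpos]
    exact max_le h1 h2

end kron₂

theorem butterfly_succ (n : ℕ) (θ : Fin (n + 1) → ℝ) :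
    butterfly (n + 1) θ = kron₂ (Real.cos (θ (Fin.last n))) (Real.sin (θ (Fin.last n)))
      (-Real.sin (θ (Fin.last n))) (Real.cos (θ (Fin.last n))) (butterfly n (Fin.init θ)) :=
  rfl

theorem maxNorm_kron₂_rotation {n : ℕ} {p q : ℝ} {c s : ℝ} (hpq : |q| ≤ |p|)
    (h : |c| = |p| ∧ |s| = |q| ∨ |c| = |q| ∧ |s| = |p|)
    (M : Matrix (Fin (2 ^ n)) (Fin (2 ^ n)) ℝ) :
    maxNorm (kron₂ c s (-s) c M) = |p| * maxNorm M := by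
  obtain ⟨i, j, hij⟩ := exists_abs_eq_maxNorm M
  have hle : ∀ x : ℝ, |x| ≤ |p| → ∀ i j, |x| * |M i j| ≤ |p| * maxNorm M := fun x hx i j =>
    mul_le_mul hx (abs_le_maxNorm M i j) (abs_nonneg _) (abs_nonneg _)
  have hc : |c| ≤ |p| := by rcases h with h | h <;> simp [h, hpq]
  have hs : |s| ≤ |p| := by rcases h with h | h <;> simp [h, hpq]
  have hbound : ∀ i j, |kron₂ c s (-s) c M i j| ≤ |p| * maxNorm M := by
    simp only [forall_halves, kron₂_inl_inl, kron₂_inl_inr, kron₂_inr_inl, kron₂_inr_inr, abs_mul,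
      abs_neg]
    exact ⟨fun i => ⟨hle c hc i, hle s hs i⟩, fun i => ⟨hle s hs i, hle c hc i⟩⟩
  rcases h with h | h
  · exact maxNorm_eq hbound (i := halves n (Sum.inl i)) (j := halves n (Sum.inl j))
      (by rw [kron₂_inl_inl, abs_mul, hij, h.1])
  · exact maxNorm_eq hbound (i := halves n (Sum.inl i)) (j := halves n (Sum.inr j))
      (by rw [kron₂_inl_inr, abs_mul, hij, h.2])

/-! ### The factors of a butterfly matrix -/

theorem tailProduct_eq_zero {N : ℕ} (L U : Matrix (Fin N) (Fin N) ℝ) {k : ℕ} (hk : N ≤ k) :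
    tailProduct L U k = 0 := by
  ext i j
  simp only [tailProduct, Matrix.of_apply, Matrix.zero_apply]
  exact Finset.sum_eq_zero fun l _ => if_neg (by omega)

section

variable {n : ℕ} (a p q r : ℝ) (L U : Matrix (Fin (2 ^ n)) (Fin (2 ^ n)) ℝ) (k : ℕ)
  (i j : Fin (2 ^ n))

/-- An index `2 ^ n + l` of the second half is at least `k` exactly when `l ≥ k - 2 ^ n`. Truncated
subtraction is what is wanted: for `k ≤ 2 ^ n` the second half contributes its whole product. -/
theorem tailProduct_kron₂_aux (x y z w : ℝ) :
    (∑ l : Fin (2 ^ n), if k ≤ (l : ℕ) then x * L i l * (y * U l j) else 0) +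
      (∑ l : Fin (2 ^ n), if k ≤ 2 ^ n + (l : ℕ) then z * L i l * (w * U l j) else 0) =
    x * y * tailProduct L U k i j + z * w * tailProduct L U (k - 2 ^ n) i j := by
  simp only [tailProduct, Matrix.of_apply, Finset.mul_sum, mul_ite, mul_zero, tsub_le_iff_left]
  congr 1 <;> exact Finset.sum_congr rfl fun l _ => by congr 1; ring

theorem tailProduct_kron₂_inl_inl :
    tailProduct (kron₂ 1 0 a 1 L) (kron₂ p q 0 r U) k (halves n (Sum.inl i))
      (halves n (Sum.inl j)) = p * tailProduct L U k i j := by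
  rw [tailProduct, Matrix.of_apply, sum_halves]
  simp only [val_halves_inl, val_halves_inr, kron₂_inl_inl, kron₂_inl_inr, kron₂_inr_inl,
    tailProduct_kron₂_aux]
  ring

theorem tailProduct_kron₂_inl_inr :
    tailProduct (kron₂ 1 0 a 1 L) (kron₂ p q 0 r U) k (halves n (Sum.inl i))
      (halves n (Sum.inr j)) = q * tailProduct L U k i j := by
  rw [tailProduct, Matrix.of_apply, sum_halves]
  simp only [val_halves_inl, val_halves_inr, kron₂_inl_inl, kron₂_inl_inr, kron₂_inr_inr,
    tailProduct_kron₂_aux]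
  ring

theorem tailProduct_kron₂_inr_inl :
    tailProduct (kron₂ 1 0 a 1 L) (kron₂ p q 0 r U) k (halves n (Sum.inr i))
      (halves n (Sum.inl j)) = a * p * tailProduct L U k i j := by
  rw [tailProduct, Matrix.of_apply, sum_halves]
  simp only [val_halves_inl, val_halves_inr, kron₂_inl_inl, kron₂_inr_inl, kron₂_inr_inr,
    tailProduct_kron₂_aux]
  ring

theorem tailProduct_kron₂_inr_inr :
    tailProduct (kron₂ 1 0 a 1 L) (kron₂ p q 0 r U) k (halves n (Sum.inr i))
      (halves n (Sum.inr j)) =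
      a * q * tailProduct L U k i j + r * tailProduct L U (k - 2 ^ n) i j := by
  rw [tailProduct, Matrix.of_apply, sum_halves]
  simp only [val_halves_inl, val_halves_inr, kron₂_inl_inr, kron₂_inr_inl, kron₂_inr_inr,
    tailProduct_kron₂_aux]
  ring

end

theorem halves_inl_lt_inl {n : ℕ} {i j : Fin (2 ^ n)} :
    halves n (Sum.inl i) < halves n (Sum.inl j) ↔ i < j := by
  rw [Fin.lt_def, Fin.lt_def, val_halves_inl, val_halves_inl]

theorem halves_inr_lt_inr {n : ℕ} {i j : Fin (2 ^ n)} :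
    halves n (Sum.inr i) < halves n (Sum.inr j) ↔ i < j := by
  rw [Fin.lt_def, Fin.lt_def, val_halves_inr, val_halves_inr, Nat.add_lt_add_iff_left]

theorem halves_inr_not_lt_inl {n : ℕ} {i j : Fin (2 ^ n)} :
    ¬ halves n (Sum.inr i) < halves n (Sum.inl j) := by
  rw [Fin.lt_def, val_halves_inl, val_halves_inr]
  omega

/-- The block `a L` contains the diagonal of `L`, so `|a| < 1` must be strict; for the block `q U`,
only compared with pivots in its row, `|q| ≤ |p|` suffices. -/
theorem IsRookLU.kron₂ {n : ℕ} {L U : Matrix (Fin (2 ^ n)) (Fin (2 ^ n)) ℝ} (h : IsRookLU L U)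
    {a p q r : ℝ} (ha : |a| < 1) (hqp : |q| ≤ |p|) (hp : p ≠ 0) (hr : r ≠ 0) :
    IsRookLU (kron₂ 1 0 a 1 L) (kron₂ p q 0 r U) where
  diag := by simp [forall_halves, h.diag]
  lower := by
    simp only [forall_halves, halves_inl_lt_inl, halves_inr_lt_inr, kron₂_inl_inl, kron₂_inl_inr,
      kron₂_inr_inl, kron₂_inr_inr, halves_inr_not_lt_inl, false_imp_iff, zero_mul, one_mul,
      implies_true, and_true, true_and]
    exact ⟨h.lower, h.lower⟩
  lt_one := by
    simp only [forall_halves, halves_inl_lt_inl, halves_inr_lt_inr, kron₂_inl_inl, kron₂_inl_inr,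
      kron₂_inr_inl, kron₂_inr_inr, halves_inr_not_lt_inl, false_imp_iff, one_mul,
      implies_true, and_true]
    refine ⟨h.lt_one, fun i => ⟨fun j _ => ?_, h.lt_one i⟩⟩
    rw [abs_mul]
    exact mul_lt_one_of_nonneg_of_lt_one_left (abs_nonneg _) ha (h.abs_le_one i j)
  upper := by
    simp only [forall_halves, halves_inl_lt_inl, halves_inr_lt_inr, kron₂_inl_inl, kron₂_inl_inr,
      kron₂_inr_inl, kron₂_inr_inr, halves_inr_not_lt_inl, false_imp_iff, zero_mul,
      implies_true, and_true, true_and]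
    exact ⟨fun i j hij => by rw [h.upper i j hij, mul_zero],
      fun i j hij => by rw [h.upper i j hij, mul_zero]⟩
  pivot_ne_zero := by simp [forall_halves, h.pivot_ne_zero, hp, hr]
  row_le := by
    simp only [forall_halves, kron₂_inl_inl, kron₂_inl_inr, kron₂_inr_inl, kron₂_inr_inr, abs_mul,
      abs_zero, zero_mul]
    exact ⟨fun i => ⟨fun j => mul_le_mul_of_nonneg_left (h.row_le i j) (abs_nonneg _),
      fun j => mul_le_mul hqp (h.row_le i j) (abs_nonneg _) (abs_nonneg _)⟩,
      fun i => ⟨fun _ => by positivity,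
        fun j => mul_le_mul_of_nonneg_left (h.row_le i j) (abs_nonneg _)⟩⟩

/-- Both the part of `L * U` eliminated by the first `k` steps and the remaining part grow at most
by the factor `|p|⁻¹` in a Kronecker product. -/
theorem abs_tailProduct_kron₂_le {n : ℕ} {L U : Matrix (Fin (2 ^ n)) (Fin (2 ^ n)) ℝ} {G : ℝ}
    (hG : ∀ (k : ℕ) i j, |tailProduct L U k i j| ≤ G ∧ |(L * U) i j - tailProduct L U k i j| ≤ G)
    {p q ε : ℝ} (hε : ε = 1 ∨ ε = -1) (hp : p ≠ 0) (hpq : p ^ 2 + q ^ 2 = 1) (k : ℕ)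
    (i j : Fin (2 ^ (n + 1))) :
    |tailProduct (kron₂ 1 0 (-(ε * q / p)) 1 L) (kron₂ p q 0 (ε / p) U) k i j| ≤ |p|⁻¹ * G ∧
    |(kron₂ 1 0 (-(ε * q / p)) 1 L * kron₂ p q 0 (ε / p) U) i j -
      tailProduct (kron₂ 1 0 (-(ε * q / p)) 1 L) (kron₂ p q 0 (ε / p) U) k i j| ≤ |p|⁻¹ * G := by
  have hp0 : 0 < |p| := abs_pos.2 hp
  have hp1 : |p| ≤ 1 := (sq_le_one_iff_abs_le_one p).1 (by nlinarith [sq_nonneg q])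
  have hq1 : |q| ≤ 1 := (sq_le_one_iff_abs_le_one q).1 (by nlinarith [sq_nonneg p])
  have hinv : 1 ≤ |p|⁻¹ := (one_le_inv₀ hp0).2 hp1
  have hε1 : |ε| = 1 := by rcases hε with h | h <;> simp [h]
  have hap : -(ε * q / p) * p = -(ε * q) := by field_simp
  have small : ∀ x y : ℝ, |x| ≤ 1 → |y| ≤ G → |x * y| ≤ |p|⁻¹ * G := fun x y hx hy => by
    rw [abs_mul]
    exact mul_le_mul (hx.trans hinv) hy (abs_nonneg _) (by positivity)
  have hap1 : |-(ε * q / p) * p| ≤ 1 := by rw [hap, abs_neg, abs_mul, hε1, one_mul]; exact hq1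
  -- This is for the lower right block, the only one where the factor `|p|⁻¹` really occurs: there
  -- `x` and `y` come from the first and the second half of the elimination.
  have big : ∀ x y : ℝ, |y - q ^ 2 * x| ≤ G →
      |-(ε * q / p) * q * x + ε / p * y| ≤ |p|⁻¹ * G := fun x y hxy => by
    have : -(ε * q / p) * q * x + ε / p * y = ε * p⁻¹ * (y - q ^ 2 * x) := by ring
    rw [this, abs_mul, abs_mul, hε1, one_mul, abs_inv]
    exact mul_le_mul_of_nonneg_left hxy (by positivity)
  -- Since `p ^ 2 + q ^ 2 = 1`, each `y - q ^ 2 * x` that arises is a convex combination of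
  -- eliminated and remaining parts, up to sign. For instance `LU - q ^ 2 T = p ^ 2 LU + q ^ 2 (LU -
  -- T)`, which is why both parts must be bounded in the induction.
  have convex : ∀ x y : ℝ, |x| ≤ G → |y| ≤ G → |p ^ 2 * x + q ^ 2 * y| ≤ G := fun x y hx hy => by
    rw [abs_le] at *
    constructor <;> nlinarith [sq_nonneg p, sq_nonneg q]
  have hp2 : p ^ 2 = 1 - q ^ 2 := by linarith
  have hL : ∀ i j, |(L * U) i j| ≤ G := fun i j => by
    simpa [tailProduct_zero] using (hG 0 i j).1
  revert i j
  simp only [forall_halves, ← tailProduct_zero, tailProduct_kron₂_inl_inl,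
    tailProduct_kron₂_inl_inr, tailProduct_kron₂_inr_inl, tailProduct_kron₂_inr_inr,
    zero_tsub, ← mul_sub]
  rw [tailProduct_zero]
  refine ⟨fun i => ⟨fun j => ⟨small _ _ hp1 (hG k i j).1, small _ _ hp1 (hG k i j).2⟩,
    fun j => ⟨small _ _ hq1 (hG k i j).1, small _ _ hq1 (hG k i j).2⟩⟩,
    fun i => ⟨fun j => ⟨small _ _ hap1 (hG k i j).1, small _ _ hap1 (hG k i j).2⟩, fun j => ?_⟩⟩
  obtain ⟨h1, h2⟩ := hG k i j
  obtain ⟨h3, h4⟩ := hG (k - 2 ^ n) i j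
  rw [add_sub_add_comm, ← mul_sub, ← mul_sub]
  rcases le_total k (2 ^ n) with hk | hk
  -- During the first half the second-half tail is still the full product; afterwards the first-half
  -- tail is zero.
  · rw [Nat.sub_eq_zero_of_le hk, tailProduct_zero]
    constructor
    · refine big _ _ ?_
      have := convex _ _ (hL i j) h2
      rw [hp2] at this
      convert this using 2
      ring
    · refine big _ _ ?_
      have := convex 0 (-((L * U) i j - tailProduct L U k i j))
        (by simpa using (abs_nonneg _).trans h1) (by rwa [abs_neg])
      convert this using 2
      ring
  · rw [tailProduct_eq_zero L U hk]
    constructor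
    · refine big _ _ ?_
      simpa using h3
    · refine big _ _ ?_
      have := convex _ (-tailProduct L U (k - 2 ^ n) i j) h4 (by rwa [abs_neg])
      rw [hp2] at this
      convert this using 2
      simp only [Matrix.zero_apply]
      ring

/-- The smaller one of `|x|` and `|x|⁻¹`. -/
noncomputable def foldAbs (x : ℝ) : ℝ := if |x| < 1 then |x| else |x|⁻¹

/-- The angles for which all pivots are unique and no entry in the first row vanishes. -/
def GenericAngle (x : ℝ) : Prop := Real.cos x ≠ 0 ∧ |Real.cos x| ≠ |Real.sin x|

/-- A two by two rotation, its rows sorted by the modulus of the first entry: these become `(p, q)`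
and `ε (-q, p)`. -/
theorem GenericAngle.exists_sorted {x : ℝ} (hx : GenericAngle x) :
    ∃ p q ε : ℝ, p ≠ 0 ∧ |q| < |p| ∧ p ^ 2 + q ^ 2 = 1 ∧ |q| = |p| * foldAbs (Real.tan x) ∧
      (ε = 1 ∧ Real.cos x = p ∧ Real.sin x = q ∨ ε = -1 ∧ Real.cos x = q ∧ Real.sin x = -p) := by
  obtain ⟨hc, hne⟩ := hx
  have hc' := abs_pos.2 hc
  rcases hne.lt_or_gt with h | h
  · have hs : Real.sin x ≠ 0 := abs_pos.1 (hc'.trans h)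
    -- The second row `(-sin, cos)` comes first, and `ε = -1` turns `(-q, p)` into the original
    -- first row.
    refine ⟨-Real.sin x, Real.cos x, -1, neg_ne_zero.2 hs, by rwa [abs_neg], ?_, ?_,
      Or.inr ⟨rfl, rfl, (neg_neg _).symm⟩⟩
    · rw [neg_sq, Real.sin_sq_add_cos_sq]
    · rw [foldAbs, Real.tan_eq_sin_div_cos, abs_div, if_neg, abs_neg]
      · have := abs_pos.2 hs
        field_simp
      · rw [div_lt_one hc']; exact h.not_gt
  · refine ⟨Real.cos x, Real.sin x, 1, hc, h, Real.cos_sq_add_sin_sq x, ?_, Or.inl ⟨rfl, rfl, rfl⟩⟩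
    rw [foldAbs, Real.tan_eq_sin_div_cos, abs_div, if_pos]
    · field_simp
    · rwa [div_lt_one hc']

/-- Induction on `n`, with one Kronecker factor per angle. The rotation has max norm `|p|` and row
sums `|p| (1 + t)`, while the largest entry of its upper factor is `|p|⁻¹ = |p| (1 + t ^ 2)`; both
norms are multiplicative here, so the ratios multiply. -/
theorem exists_isRookLU_butterfly (n : ℕ) (θ : Fin n → ℝ) (hθ : ∀ i, GenericAngle (θ i)) :
    ∃ (π : Equiv.Perm (Fin (2 ^ n))) (L U : Matrix (Fin (2 ^ n)) (Fin (2 ^ n)) ℝ) (G : ℝ),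
      (butterfly n θ).submatrix π id = L * U ∧ IsRookLU L U ∧
      (∀ (k : ℕ) i j, |tailProduct L U k i j| ≤ G ∧ |(L * U) i j - tailProduct L U k i j| ≤ G) ∧
      (∃ i j, |U i j| = G) ∧ 0 < maxNorm (butterfly n θ) ∧ 0 < infNorm (butterfly n θ) ∧
      G = maxNorm (butterfly n θ) * ∏ i, (1 + foldAbs (Real.tan (θ i)) ^ 2) ∧
      infNorm (L.map (fun x => |x|) * U.map fun x => |x|) = infNorm (butterfly n θ) *
        ∏ i, (1 + foldAbs (Real.tan (θ i)) + 2 * foldAbs (Real.tan (θ i)) ^ 2) /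
          (1 + foldAbs (Real.tan (θ i))) ∧
      infNorm L * infNorm U = infNorm (butterfly n θ) * ∏ i, (1 + foldAbs (Real.tan (θ i))) := by
  induction n with
  | zero =>
    have hbut : butterfly 0 θ = 1 := rfl
    have : Subsingleton (Fin (2 ^ 0)) := inferInstanceAs (Subsingleton (Fin 1))
    have hone : ∀ i j : Fin (2 ^ 0), (1 : Matrix (Fin (2 ^ 0)) (Fin (2 ^ 0)) ℝ) i j = 1 := by
      intro i j
      rw [Subsingleton.elim i j, Matrix.one_apply_eq]
    have hlt : ∀ i j : Fin (2 ^ 0), ¬ i < j := fun i j => by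
      rw [Subsingleton.elim i j]; exact lt_irrefl _
    have habs : (1 : Matrix (Fin (2 ^ 0)) (Fin (2 ^ 0)) ℝ).map (fun x => |x|) = 1 := by
      ext i j; simp [hone]
    have hmax : maxNorm (1 : Matrix (Fin (2 ^ 0)) (Fin (2 ^ 0)) ℝ) = 1 :=
      maxNorm_eq (fun i j => by simp [hone]) (i := 0) (j := 0) (by simp)
    have hinf : infNorm (1 : Matrix (Fin (2 ^ 0)) (Fin (2 ^ 0)) ℝ) = 1 := by
      obtain ⟨i, hi⟩ := exists_sum_abs_eq_infNorm (1 : Matrix (Fin (2 ^ 0)) (Fin (2 ^ 0)) ℝ)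
      rw [← hi]; simp [hone]
    have hbound : ∀ (k : ℕ) (i j : Fin (2 ^ 0)), |tailProduct 1 1 k i j| ≤ (1 : ℝ) ∧
        |(1 * 1 : Matrix (Fin (2 ^ 0)) (Fin (2 ^ 0)) ℝ) i j - tailProduct 1 1 k i j| ≤ 1 := by
      intro k i j
      rcases k.eq_zero_or_pos with rfl | hk
      · simp [tailProduct_zero, hone]
      · rw [tailProduct_eq_zero _ _ hk]
        simp [hone]
    refine ⟨1, 1, 1, 1, ?_, ⟨fun i => hone i i, fun i j h => absurd h (hlt _ _),
      fun i j h => absurd h (hlt _ _), fun i j h => absurd h (hlt _ _), fun i => by simp,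
      fun i j => by simp [hone]⟩, hbound, ⟨0, 0, by simp⟩, ?_, ?_, ?_, ?_, ?_⟩
    · ext i j
      simp only [hbut, mul_one, Matrix.submatrix_apply, hone]
    all_goals simp [hbut, hmax, hinf, habs]
  | succ n ih =>
    obtain ⟨π, L, U, G, hA, hLU, hG, ⟨i, j, hij⟩, hmax, hinf, hGeq, habs, hnorm⟩ :=
      ih (Fin.init θ) fun i => hθ _
    obtain ⟨p, q, ε, hp, hqp, hpq, ht, hcs⟩ := (hθ (Fin.last n)).exists_sorted
    have hp0 : 0 < |p| := abs_pos.2 hp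
    have hε : ε = 1 ∨ ε = -1 := hcs.imp And.left And.left
    have hε1 : |ε| = 1 := by rcases hε with h | h <;> simp [h]
    have hε0 : ε ≠ 0 := by rcases hε with h | h <;> simp [h]
    set t := foldAbs (Real.tan (θ (Fin.last n))) with htdef
    have ht' : t = |q| / |p| := by rw [ht]; field_simp
    have ht0 : 0 ≤ t := by rw [ht']; positivity
    have ht1 : t < 1 := by rw [ht', div_lt_one hp0]; exact hqp
    have hp2 : |p| ^ 2 * (1 + t ^ 2) = 1 := by
      rw [mul_add, mul_one, ← mul_pow, ← ht, sq_abs, sq_abs, hpq]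
    have hpinv : |p|⁻¹ = |p| * (1 + t ^ 2) := by
      field_simp
      linarith
    have ha : |-(ε * q / p)| = t := by rw [abs_neg, abs_div, abs_mul, hε1, one_mul, ht']
    have hr : |ε / p| = |p|⁻¹ := by rw [abs_div, hε1, one_div]
    have hrot : |Real.cos (θ (Fin.last n))| = |p| ∧ |Real.sin (θ (Fin.last n))| = |q| ∨
        |Real.cos (θ (Fin.last n))| = |q| ∧ |Real.sin (θ (Fin.last n))| = |p| := by
      rcases hcs with h | h
      · left; simp [h]
      · right; simp [h]
    have hmaxB : maxNorm (butterfly (n + 1) θ) = |p| * maxNorm (butterfly n (Fin.init θ)) := by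
      rw [butterfly_succ, maxNorm_kron₂_rotation hqp.le hrot]
    have hinfB : infNorm (butterfly (n + 1) θ) =
        |p| * (1 + t) * infNorm (butterfly n (Fin.init θ)) := by
      rw [butterfly_succ, infNorm_kron₂, abs_neg, add_comm |Real.sin _|, max_self, mul_add, mul_one,
        ← ht]
      rcases hrot with h | h
      · rw [h.1, h.2]
      · rw [h.1, h.2, add_comm |q|]
    have hLUblock : kron₂ 1 0 (-(ε * q / p)) 1 L * kron₂ p q 0 (ε / p) U =
        kron₂ p q (-(ε * q)) (ε * p) ((butterfly n (Fin.init θ)).submatrix π id) := by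
      rw [kron₂_mul, hA]
      congr 1
      · ring
      · ring
      · field_simp
        ring
      · field_simp
        linear_combination -hpq
    obtain ⟨π', hπ'⟩ : ∃ π' : Equiv.Perm (Fin (2 ^ (n + 1))),
        (butterfly (n + 1) θ).submatrix π' id =
          kron₂ p q (-(ε * q)) (ε * p) ((butterfly n (Fin.init θ)).submatrix π id) := by
      rcases hcs with ⟨h1, h2, h3⟩ | ⟨h1, h2, h3⟩
      · refine ⟨_, (congrArg (fun M => Matrix.submatrix M _ id) (butterfly_succ n θ)).trans
          ((kron₂_submatrix _ _ _ _ _ π).trans ?_)⟩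
        rw [h1, h2, h3, one_mul, one_mul]
      · refine ⟨_, (congrArg (fun M => Matrix.submatrix M _ id) (butterfly_succ n θ)).trans
          ((kron₂_submatrix_swap _ _ _ _ _ π).trans ?_)⟩
        rw [h1, h2, h3]
        simp
    refine ⟨π', kron₂ 1 0 (-(ε * q / p)) 1 L, kron₂ p q 0 (ε / p) U, |p|⁻¹ * G,
      hπ'.trans hLUblock.symm, hLU.kron₂ (by rw [ha]; exact ht1) hqp.le hp (div_ne_zero hε0 hp),
      abs_tailProduct_kron₂_le hG hε hp hpq, ⟨halves n (Sum.inr i), halves n (Sum.inr j), ?_⟩,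
      by rw [hmaxB]; positivity, by rw [hinfB]; positivity, ?_, ?_, ?_⟩
    · rw [kron₂_inr_inr, abs_mul, hr, hij]
    · rw [Fin.prod_univ_castSucc, ← htdef, hmaxB, hGeq, hpinv]
      simp only [Fin.init]
      ring
    · rw [Fin.prod_univ_castSucc, ← htdef, hinfB, kron₂_map_abs, kron₂_map_abs, kron₂_mul,
        infNorm_kron₂, habs, ha, hr, ht, hpinv, abs_one, abs_zero]
      simp only [one_mul, zero_mul, mul_zero, add_zero]
      have h1 : 0 ≤ |p| * t := by positivity
      have h2 : 0 ≤ t * (|p| * t) + |p| * (1 + t ^ 2) := by positivity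
      -- The row sums of the two by two product of absolute values are `|p| (1 + t)` and `|p| (1 + t
      -- + 2t ^ 2)`; the second dominates.
      rw [abs_abs, mul_comm t |p|, abs_of_nonneg h1, abs_of_nonneg h2, max_eq_right]
      · simp only [Fin.init]
        field_simp
        ring_nf
      · nlinarith [mul_nonneg hp0.le (sq_nonneg t)]
    · rw [Fin.prod_univ_castSucc, ← htdef, hinfB, infNorm_kron₂, infNorm_kron₂, ha, hr, ht, hpinv,
        max_eq_right, max_eq_left]
      · rw [mul_mul_mul_comm, hnorm, abs_one]
        simp only [Fin.init]
        ring
      · rw [abs_zero]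
        -- The first row of the upper factor dominates because `1 + t ^ 2 ≤ 1 + t`.
        nlinarith [mul_nonneg hp0.le (mul_nonneg ht0 (sub_nonneg.2 ht1.le))]
      · rw [abs_one, abs_zero]
        linarith

/-! ### Growth factors at generic angles -/

section

variable {n : ℕ} {θ : Fin n → ℝ} {σ : PivotRule (2 ^ n)}

theorem growthMax_butterfly (hθ : ∀ i, GenericAngle (θ i))
    (hσ : IsPartialPivoting σ ∨ IsRookPivoting σ) :
    growthMax σ (butterfly n θ) = ∏ i, (1 + foldAbs (Real.tan (θ i)) ^ 2) := by
  obtain ⟨π, L, U, G, hA, hLU, hG, hU, hmax, -, hGeq, -, -⟩ := exists_isRookLU_butterfly n θ hθ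
  rw [hLU.growthMax_eq hσ π hA (fun k i j => (hG k i j).1) hU, hGeq, mul_div_cancel_left₀ _ hmax.ne']

theorem growthO_butterfly (hθ : ∀ i, GenericAngle (θ i))
    (hσ : IsPartialPivoting σ ∨ IsRookPivoting σ) :
    growthO σ (butterfly n θ) =
      ∏ i, (1 + foldAbs (Real.tan (θ i)) + 2 * foldAbs (Real.tan (θ i)) ^ 2) /
        (1 + foldAbs (Real.tan (θ i))) := by
  obtain ⟨π, L, U, G, hA, hLU, -, -, -, hinf, -, h, -⟩ := exists_isRookLU_butterfly n θ hθ
  obtain ⟨hL, hU⟩ := hLU.geL_eq_and_geU_eq hσ π hA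
  rw [growthO, hL, hU, h, mul_div_cancel_left₀ _ hinf.ne']

theorem growthInf_butterfly (hθ : ∀ i, GenericAngle (θ i))
    (hσ : IsPartialPivoting σ ∨ IsRookPivoting σ) :
    growthInf σ (butterfly n θ) = ∏ i, (1 + foldAbs (Real.tan (θ i))) := by
  obtain ⟨π, L, U, G, hA, hLU, -, -, -, hinf, -, -, h⟩ := exists_isRookLU_butterfly n θ hθ
  obtain ⟨hL, hU⟩ := hLU.geL_eq_and_geU_eq hσ π hA
  rw [growthInf, hL, hU, h, mul_div_cancel_left₀ _ hinf.ne']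

end

/-! ### Functions of the angles as functions of the matrix -/

/-- The product of the values of `φ` at the tangents of the angles of a butterfly matrix, computed
from the entries of the matrix. -/
noncomputable def tanProd (φ : ℝ → ℝ) : (n : ℕ) → Matrix (Fin (2 ^ n)) (Fin (2 ^ n)) ℝ → ℝ
  | 0, _ => 1
  | n + 1, M =>
    tanProd φ n (M.submatrix (halves n ∘ Sum.inl) (halves n ∘ Sum.inl)) *
      φ (M (halves n (Sum.inl 0)) (halves n (Sum.inr 0)) /
        M (halves n (Sum.inl 0)) (halves n (Sum.inl 0)))

theorem measurable_matrix_apply {N : ℕ} (i j : Fin N) :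
    Measurable fun M : Matrix (Fin N) (Fin N) ℝ => M i j :=
  (measurable_pi_apply j).comp (measurable_pi_apply i)

theorem measurable_tanProd {φ : ℝ → ℝ} (hφ : Measurable φ) (n : ℕ) : Measurable (tanProd φ n) := by
  induction n with
  | zero => exact measurable_const
  | succ n ih =>
    refine (ih.comp ?_).mul (hφ.comp ?_)
    · exact measurable_pi_lambda _ fun i => measurable_pi_lambda _ fun j =>
        measurable_matrix_apply _ _
    · exact (measurable_matrix_apply _ _).div (measurable_matrix_apply _ _)

theorem butterfly_zero_zero_ne_zero (n : ℕ) (θ : Fin n → ℝ) (hθ : ∀ i, Real.cos (θ i) ≠ 0) :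
    butterfly n θ 0 0 ≠ 0 := by
  induction n with
  | zero => simp [butterfly]
  | succ n ih =>
    have h0 : (0 : Fin (2 ^ (n + 1))) = halves n (Sum.inl 0) := by
      apply Fin.ext
      rw [val_halves_inl]
      rfl
    rw [butterfly_succ, h0, kron₂_inl_inl]
    exact mul_ne_zero (hθ _) (ih _ fun i => hθ _)

/-- The upper left block is a cosine times a smaller butterfly matrix, so the induction needs an
arbitrary scalar; it cancels in the quotients. -/
theorem tanProd_smul_butterfly (φ : ℝ → ℝ) (n : ℕ) (θ : Fin n → ℝ)
    (hθ : ∀ i, Real.cos (θ i) ≠ 0) {a : ℝ} (ha : a ≠ 0) :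
    tanProd φ n (a • butterfly n θ) = ∏ i, φ (Real.tan (θ i)) := by
  induction n generalizing a with
  | zero => simp [tanProd]
  | succ n ih =>
    have h0 := butterfly_zero_zero_ne_zero n (Fin.init θ) fun i => hθ _
    have hsub : (a • butterfly (n + 1) θ).submatrix (halves n ∘ Sum.inl) (halves n ∘ Sum.inl) =
        (a * Real.cos (θ (Fin.last n))) • butterfly n (Fin.init θ) := by
      ext i j
      simp [butterfly_succ, mul_assoc]
    rw [tanProd, hsub, ih (Fin.init θ) (fun i => hθ _) (mul_ne_zero ha (hθ _)), Fin.prod_univ_castSucc]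
    congr 2
    simp only [butterfly_succ, Matrix.smul_apply, kron₂_inl_inl, kron₂_inl_inr, smul_eq_mul]
    rw [mul_div_mul_left _ _ ha, mul_div_mul_right _ _ h0,
      Real.tan_eq_sin_div_cos]

theorem tanProd_butterfly (φ : ℝ → ℝ) (n : ℕ) (θ : Fin n → ℝ)
    (hθ : ∀ i, Real.cos (θ i) ≠ 0) : tanProd φ n (butterfly n θ) = ∏ i, φ (Real.tan (θ i)) := by
  simpa using tanProd_smul_butterfly φ n θ hθ one_ne_zero

/-! ### Almost sure genericity, and transfer to the law of the matrix -/

theorem continuous_butterfly (n : ℕ) : Continuous (butterfly n) := by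
  induction n with
  | zero => exact continuous_const
  | succ n ih =>
    have hA : Continuous fun θ : Fin (n + 1) → ℝ => butterfly n (Fin.init θ) :=
      ih.comp (continuous_pi fun k => continuous_apply _)
    have hA' : ∀ i j, Continuous fun θ : Fin (n + 1) → ℝ => butterfly n (Fin.init θ) i j :=
      fun i j => (continuous_apply j).comp ((continuous_apply i).comp hA)
    refine continuous_pi fun i => continuous_pi fun j => ?_
    simp only [butterfly_succ]
    revert i j
    simp only [forall_halves, kron₂_inl_inl, kron₂_inl_inr, kron₂_inr_inl, kron₂_inr_inr]
    refine ⟨fun i => ⟨fun j => ?_, fun j => ?_⟩, fun i => ⟨fun j => ?_, fun j => ?_⟩⟩ <;>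
    exact Continuous.mul (by fun_prop) (hA' i j)

theorem isOpen_genericAngle : IsOpen {x | GenericAngle x} :=
  (isOpen_ne_fun Real.continuous_cos continuous_const).inter
    (isOpen_ne_fun Real.continuous_cos.abs Real.continuous_sin.abs)

theorem IsOpen.isSigmaCompact {X : Type*} [TopologicalSpace X] [LocallyCompactSpace X]
    [SecondCountableTopology X] {s : Set X} (hs : IsOpen s) : IsSigmaCompact s := by
  have := hs.locallyCompactSpace
  exact isSigmaCompact_iff_sigmaCompactSpace.2 inferInstance

theorem IsSigmaCompact.measurableSet {X : Type*} [TopologicalSpace X] [T2Space X]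
    [MeasurableSpace X] [OpensMeasurableSpace X] {s : Set X} (hs : IsSigmaCompact s) :
    MeasurableSet s := by
  obtain ⟨K, hK, rfl⟩ := hs
  exact MeasurableSet.iUnion fun i => (hK i).measurableSet

/-- The continuous image of an open, hence σ-compact, set is σ-compact. Measurability lets a
full-measure statement about angles pass to the law of the matrix. -/
theorem measurableSet_image_butterfly (n : ℕ) :
    MeasurableSet (butterfly n '' {θ | ∀ i, GenericAngle (θ i)}) := by
  have hopen : IsOpen {θ : Fin n → ℝ | ∀ i, GenericAngle (θ i)} := by
    have := isOpen_iInter_of_finite fun i : Fin n =>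
      isOpen_genericAngle.preimage (continuous_apply (A := fun _ => ℝ) i)
    convert this
    ext θ
    simp
  have : BorelSpace (Matrix (Fin (2 ^ n)) (Fin (2 ^ n)) ℝ) :=
    inferInstanceAs (BorelSpace (Fin (2 ^ n) → Fin (2 ^ n) → ℝ))
  exact (hopen.isSigmaCompact.image (continuous_butterfly n)).measurableSet

theorem ae_genericAngle : ∀ᵐ x : ℝ, GenericAngle x := by
  have h : {x : ℝ | ¬ GenericAngle x} ⊆ Set.range fun k : ℤ => k * (Real.pi / 4) := by
    intro x hx
    -- Nongeneric angles are zeros of `sin 4x = 4 sin x cos x (cos² x - sin² x)`, hence countably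
    -- many.
    have hx : Real.sin (4 * x) = 0 := by
      rw [show 4 * x = 2 * (2 * x) by ring, Real.sin_two_mul, Real.sin_two_mul, Real.cos_two_mul']
      rcases not_and_or.1 hx with h | h
      · rw [not_not.1 h]; ring
      · rw [sq_eq_sq_iff_abs_eq_abs _ _ |>.2 (not_not.1 h)]; ring
    obtain ⟨k, hk⟩ := Real.sin_eq_zero_iff.1 hx
    exact ⟨k, by simp only; linarith⟩
  exact ((Set.countable_range _).mono h).measure_zero volume

/-- The uniform distribution on `[0, 2π)`. -/
noncomputable abbrev uniformAngle : Measure ℝ :=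
  (volume : Measure ℝ)[|Set.Ico 0 (2 * Real.pi)]

/-- The pivoting rule is arbitrary, so `F` need not be measurable. It agrees almost everywhere with
the measurable `tanProd φ n`, to which change of variables and Fubini apply. -/
theorem integrable_and_integral_comp_of_hasLaw_haarButterfly {n : ℕ} {Ω : Type*}
    [MeasurableSpace Ω] {P : Measure Ω} {B : Ω → Matrix (Fin (2 ^ n)) (Fin (2 ^ n)) ℝ}
    (hB : HasLaw B (haarButterfly n) P) {F : Matrix (Fin (2 ^ n)) (Fin (2 ^ n)) ℝ → ℝ}
    {φ : ℝ → ℝ} (hφ : Measurable φ)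
    (hF : ∀ θ : Fin n → ℝ, (∀ i, GenericAngle (θ i)) →
      F (butterfly n θ) = ∏ i, φ (Real.tan (θ i)))
    (hint : Integrable (fun x => φ (Real.tan x)) uniformAngle) :
    Integrable (fun ω => F (B ω)) P ∧
      ∫ ω, F (B ω) ∂P = (∫ x, φ (Real.tan x) ∂uniformAngle) ^ n := by
  have hgen : ∀ᵐ θ ∂(Measure.pi fun _ : Fin n => uniformAngle), ∀ i, GenericAngle (θ i) :=
    ae_all_iff.2 fun i => (Measure.quasiMeasurePreserving_eval (fun _ : Fin n => uniformAngle) i).ae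
      (cond_absolutelyContinuous.ae_le ae_genericAngle)
  have hS : ∀ᵐ M ∂haarButterfly n, M ∈ butterfly n '' {θ | ∀ i, GenericAngle (θ i)} := by
    refine (ae_map_iff (measurable_butterfly n).aemeasurable
      (measurableSet_image_butterfly n)).2 ?_
    exact hgen.mono fun θ hθ => ⟨θ, hθ, rfl⟩
  have hFG : ∀ᵐ M ∂haarButterfly n, F M = tanProd φ n M := by
    filter_upwards [hS]
    rintro _ ⟨θ, hθ, rfl⟩
    rw [hF θ hθ, tanProd_butterfly φ n θ fun i => (hθ i).1]
  have hFB : (fun ω => F (B ω)) =ᵐ[P] tanProd φ n ∘ B :=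
    ae_of_ae_map (p := fun M => F M = tanProd φ n M) hB.aemeasurable (hB.map_eq ▸ hFG)
  have hG : tanProd φ n ∘ butterfly n =ᵐ[Measure.pi fun _ : Fin n => uniformAngle]
      fun θ => ∏ i, φ (Real.tan (θ i)) :=
    hgen.mono fun θ hθ => tanProd_butterfly φ n θ fun i => (hθ i).1
  have hmeas := measurable_tanProd hφ n
  constructor
  · rw [integrable_congr hFB, ← integrable_map_measure hmeas.aestronglyMeasurable hB.aemeasurable,
      hB.map_eq, haarButterfly, integrable_map_measure hmeas.aestronglyMeasurable
      (measurable_butterfly n).aemeasurable, integrable_congr hG]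
    exact Integrable.fintype_prod (f := fun _ x => φ (Real.tan x)) fun _ => hint
  · rw [integral_congr_ae hFB, hB.integral_comp hmeas.aestronglyMeasurable, haarButterfly,
      integral_map (measurable_butterfly n).aemeasurable hmeas.aestronglyMeasurable]
    refine (integral_congr_ae hG).trans ?_
    rw [integral_fintype_prod_eq_pow fun x => φ (Real.tan x), Fintype.card_fin]

/-! ### Averages over the circle -/

theorem foldAbs_mem_Icc (x : ℝ) : foldAbs x ∈ Set.Icc 0 1 := by
  rw [foldAbs]
  split_ifs with h
  · exact ⟨abs_nonneg x, h.le⟩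
  · exact ⟨inv_nonneg.2 (abs_nonneg x), inv_le_one_of_one_le₀ (not_lt.1 h)⟩

theorem measurable_foldAbs : Measurable foldAbs :=
  Measurable.ite (measurableSet_lt measurable_id.abs measurable_const) measurable_id.abs
    measurable_id.abs.inv

theorem foldAbs_neg (x : ℝ) : foldAbs (-x) = foldAbs x := by
  rw [foldAbs, foldAbs, abs_neg]

theorem foldAbs_inv (x : ℝ) : foldAbs x⁻¹ = foldAbs x := by
  rcases eq_or_ne x 0 with rfl | hx
  · rw [inv_zero]
  have hx' := abs_pos.2 hx
  simp only [foldAbs, abs_inv, inv_lt_one₀ hx', inv_inv]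
  rcases lt_trichotomy |x| 1 with h | h | h
  · rw [if_neg h.not_gt, if_pos h]
  · simp [h]
  · rw [if_pos h, if_neg h.not_gt]

theorem foldAbs_of_mem_Icc {x : ℝ} (hx : x ∈ Set.Icc 0 1) : foldAbs x = x := by
  rw [foldAbs, abs_of_nonneg hx.1]
  split_ifs with h
  · rfl
  · rw [le_antisymm hx.2 (not_lt.1 h), inv_one]

theorem measurable_tan : Measurable Real.tan := by
  have : Real.tan = fun x => Real.sin x / Real.cos x := funext Real.tan_eq_sin_div_cos
  rw [this]
  exact Real.measurable_sin.div Real.measurable_cos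

theorem tan_mem_Icc {x : ℝ} (hx : x ∈ Set.Icc 0 (Real.pi / 4)) : Real.tan x ∈ Set.Icc 0 1 := by
  have hπ := Real.pi_pos
  refine ⟨Real.tan_nonneg_of_nonneg_of_le_pi_div_two hx.1 (by linarith [hx.2]), ?_⟩
  rw [← Real.tan_pi_div_four]
  exact Real.strictMonoOn_tan.monotoneOn ⟨by linarith [hx.1], by linarith [hx.2]⟩
    ⟨by linarith, by linarith⟩ hx.2

/-- A quarter turn inverts the tangent up to sign. The poles are no exception, since both `tan`
there and the inverse of zero are zero. -/
theorem foldAbs_tan_add_pi_div_two (x : ℝ) :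
    foldAbs (Real.tan (x + Real.pi / 2)) = foldAbs (Real.tan x) := by
  rw [show x + Real.pi / 2 = Real.pi / 2 - -x by ring, Real.tan_pi_div_two_sub, foldAbs_inv,
    Real.tan_neg, foldAbs_neg]

/-- The integrand is even and `π/2`-periodic, so the circle splits into eight copies of `[0, π/4]`,
where `foldAbs` does nothing to the tangent; `8 / (2π) = 4/π`. Continuity on `[0, 1]` suffices for
boundedness because `foldAbs` takes values there. -/
theorem integrable_and_integral_uniformAngle {f : ℝ → ℝ} (hf : Measurable f)
    (hfc : ContinuousOn f (Set.Icc 0 1)) :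
    Integrable (fun x => f (foldAbs (Real.tan x))) uniformAngle ∧
      ∫ x, f (foldAbs (Real.tan x)) ∂uniformAngle =
        4 / Real.pi * ∫ x in 0..Real.pi / 4, f (Real.tan x) := by
  have hπ := Real.pi_pos
  set g : ℝ → ℝ := fun x => f (foldAbs (Real.tan x)) with hg
  have hgm : Measurable g := hf.comp (measurable_foldAbs.comp measurable_tan)
  obtain ⟨C, hC⟩ := isCompact_Icc.exists_bound_of_continuousOn hfc
  have hgC : ∀ x, ‖g x‖ ≤ C := fun x => hC _ (foldAbs_mem_Icc _)
  have hgi : ∀ a b, IntervalIntegrable g volume a b := fun a b =>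
    (intervalIntegrable_const (c := C)).mono_fun hgm.aestronglyMeasurable
      (Filter.Eventually.of_forall fun x => (hgC x).trans (le_abs_self C))
  have hper : Function.Periodic g (Real.pi / 2) := fun x => by
    simp only [hg, foldAbs_tan_add_pi_div_two]
  have heven : ∀ x, g (-x) = g x := fun x => by
    simp only [hg, Real.tan_neg, foldAbs_neg]
  have h1 : ∫ x in 0..2 * Real.pi, g x = 4 * ∫ x in 0..Real.pi / 2, g x := by
    have := hper.intervalIntegral_add_zsmul_eq 4 0 hgi
    simp only [zero_add, zsmul_eq_mul, Int.cast_ofNat] at this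
    rw [← this]
    congr 1
    ring
  have h2 : ∫ x in 0..Real.pi / 2, g x = ∫ x in -(Real.pi / 4)..Real.pi / 4, g x := by
    have := hper.intervalIntegral_add_eq 0 (-(Real.pi / 4))
    rwa [zero_add, show -(Real.pi / 4) + Real.pi / 2 = Real.pi / 4 by ring] at this
  have h3 : ∫ x in -(Real.pi / 4)..0, g x = ∫ x in 0..Real.pi / 4, g x := by
    have := intervalIntegral.integral_comp_neg (a := 0) (b := Real.pi / 4) g
    simp only [heven, neg_zero] at this
    exact this.symm
  have h4 : ∫ x in 0..Real.pi / 4, g x = ∫ x in 0..Real.pi / 4, f (Real.tan x) := by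
    refine intervalIntegral.integral_congr fun x hx => ?_
    rw [Set.uIcc_of_le (by positivity)] at hx
    simp only [hg, foldAbs_of_mem_Icc (tan_mem_Icc hx)]
  have hprob : IsProbabilityMeasure uniformAngle :=
    cond_isProbabilityMeasure_of_finite (by simp [hπ])
      (by simp [ENNReal.mul_eq_top])
  refine ⟨Integrable.of_bound hgm.aestronglyMeasurable C (Filter.Eventually.of_forall hgC), ?_⟩
  rw [uniformAngle, ProbabilityTheory.cond, integral_smul_measure, Real.volume_Ico, sub_zero,
    ENNReal.toReal_inv, ENNReal.toReal_ofReal (by positivity), integral_Ico_eq_integral_Ioo,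
    ← integral_Ioc_eq_integral_Ioo, ← intervalIntegral.integral_of_le (by positivity), h1, h2,
    ← intervalIntegral.integral_add_adjacent_intervals (hgi _ 0) (hgi _ _), h3, h4, smul_eq_mul]
  field_simp
  ring

/-! ### The three mean values -/

theorem cos_pos_of_mem_uIcc {x : ℝ} (hx : x ∈ Set.uIcc 0 (Real.pi / 4)) : 0 < Real.cos x := by
  have hπ := Real.pi_pos
  rw [Set.uIcc_of_le (by positivity)] at hx
  exact Real.cos_pos_of_mem_Ioo ⟨by linarith [hx.1], by linarith [hx.2]⟩

theorem tan_mem_Icc_of_mem_uIcc {x : ℝ} (hx : x ∈ Set.uIcc 0 (Real.pi / 4)) :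
    Real.tan x ∈ Set.Icc 0 1 := by
  rw [Set.uIcc_of_le (by positivity)] at hx
  exact tan_mem_Icc hx

theorem hasDerivAt_tan' {x : ℝ} (hx : Real.cos x ≠ 0) :
    HasDerivAt Real.tan (1 + Real.tan x ^ 2) x := by
  have h := Real.hasDerivAt_tan hx
  rwa [one_div, ← Real.inv_one_add_tan_sq hx, inv_inv] at h

theorem hasDerivAt_neg_log_cos {x : ℝ} (hx : Real.cos x ≠ 0) :
    HasDerivAt (fun x => -Real.log (Real.cos x)) (Real.tan x) x := by
  have h := ((Real.hasDerivAt_cos x).log hx).neg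
  rwa [neg_div, neg_neg, ← Real.tan_eq_sin_div_cos] at h

theorem continuousOn_comp_tan {f : ℝ → ℝ} (hf : ContinuousOn f (Set.Icc 0 1)) :
    ContinuousOn (fun x => f (Real.tan x)) (Set.uIcc 0 (Real.pi / 4)) :=
  hf.comp (fun _ hx => (Real.continuousAt_tan.2 (cos_pos_of_mem_uIcc hx).ne').continuousWithinAt)
    fun _ hx => tan_mem_Icc_of_mem_uIcc hx

theorem log_cos_pi_div_four : Real.log (Real.cos (Real.pi / 4)) = -(Real.log 2 / 2) := by
  rw [Real.cos_pi_div_four, Real.log_div (by positivity) (by positivity),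
    Real.log_sqrt (by positivity)]
  ring

theorem integral_one_add_tan_sq : ∫ x in 0..Real.pi / 4, (1 + Real.tan x ^ 2) = 1 := by
  rw [intervalIntegral.integral_eq_sub_of_hasDerivAt
    (fun x hx => hasDerivAt_tan' (cos_pos_of_mem_uIcc hx).ne')
    (continuousOn_comp_tan (f := fun t => 1 + t ^ 2) (by fun_prop)).intervalIntegrable]
  simp

theorem integral_one_add_tan :
    ∫ x in 0..Real.pi / 4, (1 + Real.tan x) = Real.pi / 4 + Real.log 2 / 2 := by
  rw [intervalIntegral.integral_eq_sub_of_hasDerivAt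
    (fun x hx => (hasDerivAt_id x).add (hasDerivAt_neg_log_cos (cos_pos_of_mem_uIcc hx).ne'))
    (continuousOn_comp_tan (f := fun t => 1 + t) (by fun_prop)).intervalIntegrable]
  simp only [Pi.add_apply, id, log_cos_pi_div_four, Real.cos_zero, Real.log_one]
  ring

theorem continuousOn_ratio :
    ContinuousOn (fun t : ℝ => (1 + t + 2 * t ^ 2) / (1 + t)) (Set.Icc 0 1) :=
  ContinuousOn.div (by fun_prop) (by fun_prop) fun t ht => by linarith [ht.1]

theorem integral_ratio_tan :
    ∫ x in 0..Real.pi / 4, (1 + Real.tan x + 2 * Real.tan x ^ 2) / (1 + Real.tan x) =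
      3 / 2 * Real.log 2 := by
  -- The antiderivative comes from `(1 + t + 2t ^ 2) / (1 + t) = (1 + t ^ 2) / (1 + t) + t`, as `1 +
  -- tan ^ 2` is the derivative of `tan`.
  have hderiv : ∀ x ∈ Set.uIcc 0 (Real.pi / 4),
      HasDerivAt (fun x => Real.log (1 + Real.tan x) + -Real.log (Real.cos x))
        ((1 + Real.tan x + 2 * Real.tan x ^ 2) / (1 + Real.tan x)) x := by
    intro x hx
    have hc := (cos_pos_of_mem_uIcc hx).ne'
    have ht : 1 + Real.tan x ≠ 0 := by linarith [(tan_mem_Icc_of_mem_uIcc hx).1]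
    refine ((((hasDerivAt_tan' hc).const_add 1).log ht).add
      (hasDerivAt_neg_log_cos hc)).congr_deriv ?_
    field_simp
    ring
  rw [intervalIntegral.integral_eq_sub_of_hasDerivAt hderiv
    (continuousOn_comp_tan continuousOn_ratio).intervalIntegrable]
  simp only [Real.tan_pi_div_four, log_cos_pi_div_four, Real.tan_zero, Real.cos_zero, Real.log_one,
    add_zero, neg_zero, sub_zero, neg_neg, one_add_one_eq_two]
  ring

/-! ### The incomplete beta function -/

/-- Substitute `t = 1 + tan ^ 2 x`: the factor `tan x` in the derivative cancels the singularity `(t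
- 1) ^ (-1/2)`. Open intervals avoid the endpoint `t = 1`. -/
theorem integral_rpow_mul_rpow_eq_integral_tan (k : ℝ) :
    ∫ t in (1 : ℝ)..2, t ^ (k - 1) * (t - 1) ^ (-(1 / 2) : ℝ) =
      2 * ∫ x in 0..Real.pi / 4, (1 + Real.tan x ^ 2) ^ k := by
  have hπ := Real.pi_pos
  have htan : ∀ x ∈ Set.Ioo 0 (Real.pi / 4), 0 < Real.tan x := fun x hx =>
    Real.tan_pos_of_pos_of_lt_pi_div_two hx.1 (by linarith [hx.2])
  have hmono : StrictMonoOn Real.tan (Set.Icc 0 (Real.pi / 4)) :=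
    Real.strictMonoOn_tan.mono fun x hx => ⟨by linarith [hx.1], by linarith [hx.2]⟩
  have himage : (fun x => 1 + Real.tan x ^ 2) '' Set.Ioo 0 (Real.pi / 4) = Set.Ioo 1 2 := by
    ext t
    constructor
    · rintro ⟨x, hx, rfl⟩
      have h0 := htan x hx
      have h1 := hmono (Set.Ioo_subset_Icc_self hx) ⟨by positivity, le_rfl⟩ hx.2
      rw [Real.tan_pi_div_four] at h1
      constructor
      · simp only; nlinarith
      · simp only; nlinarith
    · intro ht
      have ht0 : 0 < t - 1 := by linarith [ht.1]
      refine ⟨Real.arctan (√(t - 1)), ⟨?_, ?_⟩, ?_⟩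
      · rw [← Real.arctan_zero]
        exact Real.arctan_strictMono (Real.sqrt_pos.2 ht0)
      · rw [← Real.arctan_one]
        refine Real.arctan_strictMono ?_
        rw [Real.sqrt_lt' one_pos]
        linarith [ht.2]
      · simp only [Real.tan_arctan, Real.sq_sqrt ht0.le]
        ring
  have hinj : Set.InjOn (fun x => 1 + Real.tan x ^ 2) (Set.Ioo 0 (Real.pi / 4)) := by
    intro x hx y hy hxy
    have h : Real.tan x ^ 2 = Real.tan y ^ 2 := add_left_cancel hxy
    rw [sq_eq_sq₀ (htan x hx).le (htan y hy).le] at h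
    exact hmono.injOn (Set.Ioo_subset_Icc_self hx) (Set.Ioo_subset_Icc_self hy) h
  have hderiv : ∀ x ∈ Set.Ioo 0 (Real.pi / 4), HasDerivWithinAt (fun x => 1 + Real.tan x ^ 2)
      (2 * Real.tan x * (1 + Real.tan x ^ 2)) (Set.Ioo 0 (Real.pi / 4)) x := by
    intro x hx
    have hc : Real.cos x ≠ 0 := (Real.cos_pos_of_mem_Ioo ⟨by linarith [hx.1],
      by linarith [hx.2]⟩).ne'
    have := (((hasDerivAt_tan' hc).pow 2).const_add 1).hasDerivWithinAt
      (s := Set.Ioo 0 (Real.pi / 4))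
    simpa using this
  rw [intervalIntegral.integral_of_le one_le_two, integral_Ioc_eq_integral_Ioo, ← himage,
    integral_image_eq_integral_abs_deriv_smul measurableSet_Ioo hderiv hinj,
    intervalIntegral.integral_of_le (by positivity), integral_Ioc_eq_integral_Ioo,
    ← integral_const_mul]
  refine setIntegral_congr_fun measurableSet_Ioo fun x hx => ?_
  have h0 := htan x hx
  have h1 : 0 < 1 + Real.tan x ^ 2 := by positivity
  simp only [add_sub_cancel_left, smul_eq_mul]
  rw [abs_of_pos (by positivity), Real.rpow_sub_one h1.ne', Real.rpow_neg (by positivity),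
    ← Real.sqrt_eq_rpow, Real.sqrt_sq h0.le]
  field_simp

theorem intervalIntegrable_rpow_mul_rpow (k : ℝ) :
    IntervalIntegrable (fun t : ℝ => t ^ (k - 1) * (t - 1) ^ (-(1 / 2) : ℝ)) volume 1 2 := by
  have h : IntervalIntegrable (fun t : ℝ => (t - 1) ^ (-(1 / 2) : ℝ)) volume 1 2 := by
    have := (intervalIntegral.intervalIntegrable_rpow' (a := 0) (b := 1)
      (r := -(1 / 2)) (by norm_num)).comp_sub_right 1
    norm_num at this ⊢
    exact this
  refine h.continuousOn_mul fun t ht => ?_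
  rw [Set.uIcc_of_le one_le_two] at ht
  exact (Real.continuousAt_rpow_const _ _ (Or.inl (by linarith [ht.1]))).continuousWithinAt

/-- On `[0, 1]` the integrand is real, and integrable because `k > 0`; on `[1, 2]` it is `-i` times
a nonnegative function. Only the latter piece enters the imaginary part. -/
theorem abs_im_incompleteBeta_two {k : ℝ} (hk : 0 < k) :
    |(incompleteBeta 2 k (1 / 2)).im| = 2 * ∫ x in 0..Real.pi / 4, (1 + Real.tan x ^ 2) ^ k := by
  have h01 : ∫ t : ℝ in 0..1, (t : ℂ) ^ ((k : ℂ) - 1) * (1 - (t : ℂ)) ^ ((1 / 2 : ℂ) - 1) =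
      ((∫ t : ℝ in 0..1, t ^ (k - 1) * (1 - t) ^ (-(1 / 2) : ℝ) : ℝ) : ℂ) := by
    rw [← intervalIntegral.integral_ofReal]
    refine intervalIntegral.integral_congr fun t ht => ?_
    rw [Set.uIcc_of_le zero_le_one] at ht
    simp only [Complex.ofReal_mul]
    rw [Complex.ofReal_cpow ht.1, Complex.ofReal_cpow (by linarith [ht.2])]
    push_cast
    norm_num
  have heq : Set.EqOn (fun t : ℝ => -Complex.I *
        ((t ^ (k - 1) * (t - 1) ^ (-(1 / 2) : ℝ) : ℝ) : ℂ))
      (fun t : ℝ => (t : ℂ) ^ ((k : ℂ) - 1) * (1 - (t : ℂ)) ^ ((1 / 2 : ℂ) - 1))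
      (Set.uIoo 1 2) := by
    intro t ht
    rw [Set.uIoo_of_le one_le_two] at ht
    have h1 : 1 - (t : ℂ) = ((1 - t : ℝ) : ℂ) := by push_cast; rfl
    simp only [Complex.ofReal_mul]
    rw [Complex.ofReal_cpow (by linarith [ht.1]), Complex.ofReal_cpow (by linarith [ht.1]), h1,
      Complex.ofReal_cpow_of_nonpos (x := 1 - t) (by linarith [ht.1])]
    -- The principal argument of the negative number `1 - t` is `π`, and the exponent is `-1/2`.
    have h2 : Complex.exp (Real.pi * Complex.I * ((1 / 2 : ℂ) - 1)) = -Complex.I := by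
      rw [show Real.pi * Complex.I * ((1 / 2 : ℂ) - 1) = -(Real.pi / 2 * Complex.I) by ring,
        Complex.exp_neg, Complex.exp_pi_div_two_mul_I, Complex.inv_I]
    rw [h2]
    push_cast
    rw [show (1 / 2 : ℂ) - 1 = -(1 / 2) by norm_num, neg_sub]
    ring
  have h12 : ∫ t : ℝ in 1..2, (t : ℂ) ^ ((k : ℂ) - 1) * (1 - (t : ℂ)) ^ ((1 / 2 : ℂ) - 1) =
      -Complex.I * ((∫ t : ℝ in 1..2, t ^ (k - 1) * (t - 1) ^ (-(1 / 2) : ℝ) : ℝ) : ℂ) := by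
    rw [← intervalIntegral.integral_congr_uIoo heq, intervalIntegral.integral_const_mul,
      intervalIntegral.integral_ofReal]
  have hi12 : IntervalIntegrable
      (fun t : ℝ => (t : ℂ) ^ ((k : ℂ) - 1) * (1 - (t : ℂ)) ^ ((1 / 2 : ℂ) - 1)) volume 1 2 :=
    (IntervalIntegrable.const_mul
      (f := fun t : ℝ => ((t ^ (k - 1) * (t - 1) ^ (-(1 / 2) : ℝ) : ℝ) : ℂ))
      ⟨(intervalIntegrable_rpow_mul_rpow k).1.ofReal,
        (intervalIntegrable_rpow_mul_rpow k).2.ofReal⟩ _).congr_uIoo heq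
  have hpos : 0 ≤ ∫ x in 0..Real.pi / 4, (1 + Real.tan x ^ 2) ^ k :=
    intervalIntegral.integral_nonneg (by positivity) fun x _ => by positivity
  rw [incompleteBeta, ← intervalIntegral.integral_add_adjacent_intervals
    (Complex.betaIntegral_convergent (by simpa using hk) (by norm_num)) hi12, h01, h12,
    integral_rpow_mul_rpow_eq_integral_tan]
  simp only [Complex.add_im, Complex.ofReal_im, Complex.mul_im, Complex.neg_re, Complex.neg_im,
    Complex.I_re, Complex.I_im, Complex.ofReal_re, zero_add, mul_zero, neg_zero, neg_one_mul,
    abs_neg]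
  exact abs_of_nonneg (by positivity)

theorem continuousOn_one_add_sq_rpow (k : ℝ) :
    ContinuousOn (fun t : ℝ => (1 + t ^ 2) ^ k) (Set.Icc 0 1) :=
  ContinuousOn.rpow_const (by fun_prop) fun t _ => Or.inl (by positivity)

theorem integral_one_add_tan_sq_rpow_pos (k : ℝ) :
    0 < ∫ x in 0..Real.pi / 4, (1 + Real.tan x ^ 2) ^ k :=
  intervalIntegral.intervalIntegral_pos_of_pos_on
    (continuousOn_comp_tan (continuousOn_one_add_sq_rpow k)).intervalIntegrable
    (fun x _ => by positivity) (by positivity)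

theorem two_pow_rpow_logb {x : ℝ} (hx : 0 < x) (n : ℕ) : ((2 : ℝ) ^ n) ^ Real.logb 2 x = x ^ n := by
  rw [← Real.rpow_natCast, ← Real.rpow_mul zero_le_two, mul_comm, Real.rpow_mul zero_le_two,
    Real.rpow_logb zero_lt_two (by norm_num) hx, Real.rpow_natCast]

/-! ### The expectations and moments -/

theorem corollary2p2 (n : ℕ)
    {Ω : Type*} [MeasurableSpace Ω] (P : Measure Ω)
    (B : Ω → Matrix (Fin (2 ^ n)) (Fin (2 ^ n)) ℝ) (hB : HasLaw B (haarButterfly n) P)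
    (σ : PivotRule (2 ^ n)) (hσ : IsPartialPivoting σ ∨ IsRookPivoting σ) :
    (Integrable (fun ω => growthMax σ (B ω)) P ∧
      ∫ ω, growthMax σ (B ω) ∂P = ((2 : ℝ) ^ n) ^ Real.logb 2 (4 / Real.pi)) ∧
    (Integrable (fun ω => growthO σ (B ω)) P ∧
      ∫ ω, growthO σ (B ω) ∂P = ((2 : ℝ) ^ n) ^ Real.logb 2 (6 * Real.log 2 / Real.pi)) ∧
    (Integrable (fun ω => growthInf σ (B ω)) P ∧
      ∫ ω, growthInf σ (B ω) ∂P = ((2 : ℝ) ^ n) ^ Real.logb 2 (1 + Real.log 4 / Real.pi)) ∧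
    ∀ k : ℝ, 0 < k →
      Integrable (fun ω => growthMax σ (B ω) ^ k) P ∧
      ∫ ω, growthMax σ (B ω) ^ k ∂P =
        ((2 : ℝ) ^ n) ^
          Real.logb 2 (2 / Real.pi * |(incompleteBeta 2 (k : ℂ) (1 / 2)).im|) := by
  have hπ := Real.pi_pos
  have hlog2 : 0 < Real.log 2 := Real.log_pos one_lt_two
  have hlog4 : Real.log 4 = 2 * Real.log 2 := by
    rw [show (4 : ℝ) = 2 ^ 2 by norm_num, Real.log_pow]
    norm_num
  -- All four claims have the same form and differ only in the factor `f` per angle; `c` is its mean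
  -- over the circle, and `c > 0` gives `N ^ log₂ c = c ^ n`.
  have main : ∀ (F : Matrix (Fin (2 ^ n)) (Fin (2 ^ n)) ℝ → ℝ) (f : ℝ → ℝ) (c : ℝ), Measurable f →
      ContinuousOn f (Set.Icc 0 1) → (∀ θ : Fin n → ℝ, (∀ i, GenericAngle (θ i)) →
        F (butterfly n θ) = ∏ i, f (foldAbs (Real.tan (θ i)))) → 0 < c →
      4 / Real.pi * ∫ x in 0..Real.pi / 4, f (Real.tan x) = c →
      Integrable (fun ω => F (B ω)) P ∧ ∫ ω, F (B ω) ∂P = ((2 : ℝ) ^ n) ^ Real.logb 2 c := by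
    intro F f c hfm hfc hF hc hfi
    obtain ⟨hint, hval⟩ := integrable_and_integral_uniformAngle hfm hfc
    have := integrable_and_integral_comp_of_hasLaw_haarButterfly hB
      (hfm.comp measurable_foldAbs) hF hint
    refine ⟨this.1, this.2.trans ?_⟩
    rw [two_pow_rpow_logb hc, ← hfi, ← hval]
    rfl
  refine ⟨?_, ?_, ?_, fun k hk => ?_⟩
  · refine main _ (fun t => 1 + t ^ 2) _ (by fun_prop) (by fun_prop)
      (fun θ hθ => growthMax_butterfly hθ hσ) (by positivity) ?_
    rw [integral_one_add_tan_sq, mul_one]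
  · refine main _ (fun t => (1 + t + 2 * t ^ 2) / (1 + t)) _ (by fun_prop) continuousOn_ratio
      (fun θ hθ => growthO_butterfly hθ hσ) (by positivity) ?_
    rw [integral_ratio_tan]
    ring
  · refine main _ (fun t => 1 + t) _ (by fun_prop) (by fun_prop)
      (fun θ hθ => growthInf_butterfly hθ hσ) (by rw [hlog4]; positivity) ?_
    rw [integral_one_add_tan, hlog4]
    field_simp
    ring
  · have hpos := integral_one_add_tan_sq_rpow_pos k
    refine main (fun A => growthMax σ A ^ k) (fun t => (1 + t ^ 2) ^ k) _ (by fun_prop)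
      (continuousOn_one_add_sq_rpow k) (fun θ hθ => ?_) ?_ ?_
    · simp only [growthMax_butterfly hθ hσ]
      exact (Real.finsetProd_rpow _ _ (fun i _ => by positivity) k).symm
    · rw [abs_im_incompleteBeta_two hk]
      positivity
    · rw [abs_im_incompleteBeta_two hk]
      ring
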